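/- Let $k$ be a $p$-adic field (a finite extension of some $\mathbb{Q}_p$) with ring of integers $\mathcal{O}$, residue field of size $q$ and normalized absolute value $|\ |$, and let $G$ be one of the following unramified classical groups over $k$: split $\mathrm{SO}(2n+1)$; $\mathrm{Sp}(2n)$; the quasi-split unitary group $\mathrm{U}(n)$ of the unramified quadratic extension $E/k$; split $\mathrm{SO}(2n)$; or the non-split quasi-split $\mathrm{SO}(2n)$ that splits over the unramified quadratic extension of $k$. Each is taken in its standard matrix realization, with hyperspecial maximal compact subgroup $K$ the stabilizer of the standard (self-dual, or semiregular) lattice, Borel subgroup $B=TU$ of (block) upper triangular matrices, and modulus character $\delta_B(t)=|\det(\mathrm{Ad}(t)\mid\mathrm{Lie}\,U)|$. A representation of $G(k)$ is *unramified* if it is irreducible, smooth, complex, and has a nonzero $K$-fixed vector; $I(\chi)=\mathrm{Ind}_B^G\chi$ denotes normalized induction. If $r$ is the $k$-rank of $G$ and $t_1,\dots,t_r$ (in $k^\times$, or in $E^\times$ for $\mathrm{U}(n)$) are the first $r$ diagonal entries of $t\in T(k)$, the unramified characters of $T(k)$ are $\chi_\alpha(t)=\prod_{i=1}^r\alpha_i^{\mathrm{ord}(t_i)}$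 with $\alpha\in(\mathbb{C}^\times)^r$. The same conventions apply to $\mathrm{GL}(N)$ over $F$, where $F=k$, except that $F=E$ for $\mathrm{U}(n)$. Let $N=2n,\ 2n+1,\ n,\ 2n,\ 2n$ in the five cases, and let $L(\alpha)\in\mathrm{GL}(N,\mathbb{C})$ be $\mathrm{diag}(\alpha_1,\dots,\alpha_r,1,\dots,1,\alpha_r^{-1},\dots,\alpha_1^{-1})$, multiplied, for non-split $\mathrm{SO}(2n)$, by the permutation matrix that exchanges the two middle basis vectors. (For $\mathrm{U}(n)$, $L(\alpha)=t\cdot\mathrm{Frob}(t)$ with $t=\mathrm{diag}(\alpha_1,\dots,\alpha_r,1,\dots,1)$ and $\mathrm{Frob}(t)=w\,{}^tt^{-1}w^{-1}$, $w$ anti-diagonal.) Thus $L(\alpha)$ is the image, under the standard homomorphism of L-groups, of the Satake parameter given by $\alpha$. For an unramified representation $\pi$ of $G(k)$ and a representation $\Pi$ of $\mathrm{GL}(N,F)$ we write $\Pi=\Sigma(\pi)$, and call $\Pi$ the functorial transfer of $\pi$, if $\Pi$ is unramified and there are $\alpha\in(\mathbb{C}^\times)^r$ and $\beta\in(\mathbb{C}^\times)^N$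 such that $\pi$ is a subquotient of $I(\chi_\alpha)$, $\Pi$ is a subquotient of $I(\chi_\beta)$, and $L(\alpha)$ is conjugate to $\mathrm{diag}(\beta_1,\dots,\beta_N)$ in $\mathrm{GL}(N,\mathbb{C})$. For $\sigma\in\mathrm{Aut}(\mathbb{C})$ and a representation $(\rho,V)$ let ${}^\sigma\rho$ be the representation on $V\otimes_{\mathbb{C},\sigma}\mathbb{C}$ in which the group acts on the first factor. Then for every $\sigma\in\mathrm{Aut}(\mathbb{C})$ and every unramified representation $\pi$ of $G(k)$ the representation ${}^\sigma\pi$ is unramified, and: (i) if $G=\mathrm{SO}(2n+1)$, $\mathrm{Sp}(2n)$ or $\mathrm{U}(n)$, then ${}^\sigma\Sigma(\pi)=\Sigma({}^\sigma\pi)$; that is, for every representation $\Pi$ of $\mathrm{GL}(N,F)$, $\Pi=\Sigma(\pi)$ if and only if ${}^\sigma\Pi=\Sigma({}^\sigma\pi)$; (ii) if $G=\mathrm{SO}(2n)$ (split or not), then ${}^\sigma\big(\Sigma(\pi)\otimes|\ |^{-1/2}\big)\otimes|\ |^{1/2}=\Sigma({}^\sigma\pi)$, where $\otimes|\ |^s$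 is the twist by $g\mapsto|\det g|^s$; that is, for every representation $\Pi$ of $\mathrm{GL}(2n,k)$, $\Pi=\Sigma(\pi)$ if and only if ${}^\sigma(\Pi\otimes|\ |^{-1/2})\otimes|\ |^{1/2}=\Sigma({}^\sigma\pi)$. -/

import Mathlib

open ValuativeRel

noncomputable section

namespace UnramTransfer

/-! ### Local fields: normalized valuation and absolute value -/

section LocalField

variable (F : Type*) [Field F] [ValuativeRel F] [TopologicalSpace F] [IsNonarchimedeanLocalField F]

/-- The normalized additive valuation of a non-archimedean local field: it is `0` on the units of
the ring of integers and `1` on uniformizers (with the junk value `ord 0 = 0`). -/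
def ord (x : F) : ℤ :=
  -WithZero.log (IsNonarchimedeanLocalField.valueGroupWithZeroIsoInt F (valuation F x))

/-- The normalized absolute value `|x| = q ^ (-ord x)`, with `q` the size of the residue field. -/
def normAbs (x : F) : ℝ :=
  open Classical in if x = 0 then 0 else (Nat.card 𝓀[F] : ℝ) ^ (-ord F x)

variable {F}

theorem ord_one : ord F 1 = 0 := by simp [ord]

theorem ord_mul {x y : F} (hx : x ≠ 0) (hy : y ≠ 0) : ord F (x * y) = ord F x + ord F y := by
  unfold ord
  rw [map_mul, map_mul, WithZero.log_mul (by simpa using hx) (by simpa using hy)]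
  ring

theorem normAbs_one : normAbs F 1 = 1 := by simp [normAbs, ord_one]

theorem normAbs_nonneg (x : F) : 0 ≤ normAbs F x := by
  unfold normAbs
  split_ifs <;> positivity

theorem normAbs_mul (x y : F) : normAbs F (x * y) = normAbs F x * normAbs F y := by
  by_cases hx : x = 0
  · simp [normAbs, hx]
  by_cases hy : y = 0
  · simp [normAbs, hy]
  have hq : (Nat.card 𝓀[F] : ℝ) ≠ 0 := by
    exact_mod_cast Nat.card_pos.ne'
  simp only [normAbs, hx, hy, mul_eq_zero, or_self, if_false, ord_mul hx hy]
  rw [neg_add, zpow_add₀ hq]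

end LocalField

/-! ### Complex representations -/

section Representations

/-- The complex vector space `V ⊗_{ℂ, σ} ℂ`, realized on `V` itself through
`v ⊗ c ↦ σ⁻¹(c) v`: the scalar `c` acts on it as `σ⁻¹(c)` acts on `V`. -/
def Conj (_ : ℂ ≃+* ℂ) (V : Type*) : Type _ := V

instance (σ : ℂ ≃+* ℂ) (V : Type*) [AddCommGroup V] : AddCommGroup (Conj σ V) :=
  inferInstanceAs (AddCommGroup V)

instance (σ : ℂ ≃+* ℂ) (V : Type*) [AddCommGroup V] [Module ℂ V] : Module ℂ (Conj σ V) :=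
  Module.compHom V (σ.symm : ℂ →+* ℂ)

variable {G V W : Type*} [Group G] [AddCommGroup V] [Module ℂ V] [AddCommGroup W] [Module ℂ W]

/-- The conjugate `^σ ρ`: the group acts on `V ⊗_{ℂ, σ} ℂ` through the first factor. -/
def conjRep (σ : ℂ ≃+* ℂ) (ρ : Representation ℂ G V) : Representation ℂ G (Conj σ V) where
  toFun g :=
    { toFun := fun v => ρ g (show V from v)
      map_add' := fun v w => (ρ g).map_add v w
      map_smul' := fun c v => (ρ g).map_smul (σ.symm c) v }
  map_one' := by
    ext v
    exact congrArg (fun f : V →ₗ[ℂ] V => f v) ρ.map_one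
  map_mul' g h := by
    ext v
    exact congrArg (fun f : V →ₗ[ℂ] V => f v) (ρ.map_mul g h)

/-- The twist `ρ ⊗ η` of a representation by a character. -/
def twist (η : G →* ℂ) (ρ : Representation ℂ G V) : Representation ℂ G V where
  toFun g := η g • ρ g
  map_one' := by simp
  map_mul' g h := by
    ext v
    simp [mul_smul, smul_comm (η h)]

/-- `π` is isomorphic to a subquotient of `τ`: it is a quotient of a subrepresentation of `τ`. -/
def IsSubquotient (π : Representation ℂ G V) (τ : Representation ℂ G W) : Prop :=
  ∃ (S : Subrepresentation τ) (q : S.toRepresentation.IntertwiningMap π), Function.Surjective q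

/-- Every vector has an open stabilizer. -/
def IsSmooth [TopologicalSpace G] (π : Representation ℂ G V) : Prop :=
  ∀ v, IsOpen {g : G | π g v = v}

end Representations

/-! ### Matrix groups with a Borel subgroup -/

section Group

/-- A group of invertible matrices over `R` with its Lie algebra over `k`, and a partition of the
standard basis into consecutive blocks. The block upper triangular matrices of the group will form
a Borel subgroup; `r` is the rank of its maximal split torus, on which the first `r` diagonal
entries are coordinates. -/
structure GroupDatum (k R : Type*) [Field k] [Field R] [Algebra k R] (m r : ℕ) where
  /-- the group of rational points -/
  group : Subgroup (GL (Fin m) R)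
  /-- its Lie algebra -/
  lie : Submodule k (Matrix (Fin m) (Fin m) R)
  conj_mem : ∀ g ∈ group, ∀ X ∈ lie, g.val * X * (g⁻¹).val ∈ lie
  /-- the block that contains a given basis vector -/
  block : Fin m → ℕ
  rank_le : r ≤ m

variable {k R : Type*} [Field k] [Field R] [Algebra k R] {m r : ℕ}

/-- The torus `T` of the block diagonal elements. -/
def GroupDatum.torus (D : GroupDatum k R m r) : Subgroup D.group where
  carrier := {t | ∀ i j, D.block i ≠ D.block j →
    t.val.val i j = 0 ∧ (t⁻¹).val.val i j = 0}
  one_mem' := by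
    intro i j h
    have hij : i ≠ j := fun e => h (by rw [e])
    simp [Matrix.one_apply_ne hij]
  mul_mem' := by
    intro s t hs ht i j h
    refine ⟨?_, ?_⟩
    · show (s.val.val * t.val.val) i j = 0
      rw [Matrix.mul_apply]
      refine Finset.sum_eq_zero fun l _ => ?_
      by_cases hl : D.block i = D.block l
      · rw [(ht l j (hl ▸ h)).1, mul_zero]
      · rw [(hs i l hl).1, zero_mul]
    · rw [mul_inv_rev]
      show ((t⁻¹).val.val * (s⁻¹).val.val) i j = 0
      rw [Matrix.mul_apply]
      refine Finset.sum_eq_zero fun l _ => ?_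
      by_cases hl : D.block i = D.block l
      · rw [(hs l j (hl ▸ h)).2, mul_zero]
      · rw [(ht i l hl).2, zero_mul]
  inv_mem' := by
    intro t ht i j h
    rw [inv_inv]
    exact ⟨(ht i j h).2, (ht i j h).1⟩

/-- The unipotent radical `N` of the Borel subgroup `B = T N` of block upper triangular elements. -/
def GroupDatum.unipotent (D : GroupDatum k R m r) : Set D.group :=
  {u | ∀ i j, D.block j ≤ D.block i → u.val.val i j = (1 : Matrix (Fin m) (Fin m) R) i j}

/-- The Lie algebra of `N`. -/
def GroupDatum.nilradical (D : GroupDatum k R m r) : Submodule k (Matrix (Fin m) (Fin m) R) where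
  carrier := {X | X ∈ D.lie ∧ ∀ i j, D.block j ≤ D.block i → X i j = 0}
  zero_mem' := ⟨D.lie.zero_mem, fun _ _ _ => rfl⟩
  add_mem' := fun {X Y} hX hY => ⟨D.lie.add_mem hX.1 hY.1, fun i j h => by
    rw [Matrix.add_apply, hX.2 i j h, hY.2 i j h, add_zero]⟩
  smul_mem' := fun c X hX => ⟨D.lie.smul_mem c hX.1, fun i j h => by
    rw [Matrix.smul_apply, hX.2 i j h, smul_zero]⟩

theorem GroupDatum.conj_mem_nilradical (D : GroupDatum k R m r) (t : D.torus)
    {X : Matrix (Fin m) (Fin m) R} (hX : X ∈ D.nilradical) :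
    t.val.val.val * X * ((t⁻¹).val.val.val) ∈ D.nilradical := by
  refine ⟨D.conj_mem t.val.val t.val.property X hX.1, fun i j h => ?_⟩
  rw [Matrix.mul_apply]
  refine Finset.sum_eq_zero fun l _ => ?_
  by_cases hl : D.block l = D.block j
  · have : (t.val.val.val * X) i l = 0 := by
      rw [Matrix.mul_apply]
      refine Finset.sum_eq_zero fun l' _ => ?_
      by_cases hl' : D.block i = D.block l'
      · rw [hX.2 l' l (by omega), mul_zero]
      · rw [(t.property i l' hl').1, zero_mul]
    rw [this, zero_mul]
  · rw [show ((t⁻¹).val.val.val) l j = 0 from (t.property l j hl).2, mul_zero]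

/-- The adjoint action of an element of `T` on the Lie algebra of `N`. -/
def GroupDatum.Ad (D : GroupDatum k R m r) (t : D.torus) : D.nilradical →ₗ[k] D.nilradical where
  toFun X := ⟨t.val.val.val * X.val * ((t⁻¹).val.val.val), D.conj_mem_nilradical t X.property⟩
  map_add' X Y := by
    ext1
    simp [mul_add, add_mul]
  map_smul' c X := by
    ext1
    simp

section Topological

variable [ValuativeRel k] [TopologicalSpace k] [IsNonarchimedeanLocalField k]
variable [ValuativeRel R] [TopologicalSpace R] [IsNonarchimedeanLocalField R]

/-- The modulus character `δ_B(t) = |det(Ad(t) | Lie N)|` of the Borel subgroup, on `T`. -/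
def GroupDatum.modulus (D : GroupDatum k R m r) (t : D.torus) : ℝ :=
  normAbs k (LinearMap.det (D.Ad t))

/-- The elements of the hyperspecial maximal compact subgroup: those that preserve the
standard lattice. -/
def GroupDatum.integral (D : GroupDatum k R m r) : Set D.group :=
  {g | ∀ i j, g.val.val i j ∈ 𝒪[R] ∧ (g⁻¹).val.val i j ∈ 𝒪[R]}

/-- The space of the normalized induced representation `I(χ) = Ind_B^G χ`: the functions `f` on
the group, right invariant under an open subgroup, with
`f (t u g) = χ(t) δ_B(t)^{1/2} f(g)` for `t` in `T` and `u` in `N`. -/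
def GroupDatum.indSpace (D : GroupDatum k R m r) (χ : D.torus →* ℂˣ) :
    Submodule ℂ (D.group → ℂ) where
  carrier := {f | (∃ U : Subgroup D.group, IsOpen (U : Set D.group) ∧
      ∀ g, ∀ u ∈ U, f (g * u) = f g) ∧
    ∀ t : D.torus, ∀ u ∈ D.unipotent, ∀ g,
      f (t.val * u * g) = (χ t : ℂ) * (Real.sqrt (D.modulus t) : ℂ) * f g}
  zero_mem' := ⟨⟨⊤, isOpen_univ, fun _ _ _ => rfl⟩, fun t u _ g => by simp⟩
  add_mem' := by
    rintro f f' ⟨⟨U, hU, hf⟩, h⟩ ⟨⟨U', hU', hf'⟩, h'⟩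
    refine ⟨⟨U ⊓ U', hU.inter hU', fun g u hu => ?_⟩, fun t u hu g => ?_⟩
    · simp only [Pi.add_apply]
      rw [hf g u hu.1, hf' g u hu.2]
    · simp only [Pi.add_apply]
      rw [h t u hu g, h' t u hu g, mul_add]
  smul_mem' := by
    rintro c f ⟨⟨U, hU, hf⟩, h⟩
    refine ⟨⟨U, hU, fun g u hu => ?_⟩, fun t u hu g => ?_⟩
    · simp only [Pi.smul_apply]
      rw [hf g u hu]
    · simp only [Pi.smul_apply, smul_eq_mul]
      rw [h t u hu g]
      ring

/-- The normalized induced representation `I(χ)`: the group acts by right translation. -/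
def GroupDatum.ind (D : GroupDatum k R m r) (χ : D.torus →* ℂˣ) :
    Representation ℂ D.group (D.indSpace χ) where
  toFun g :=
    { toFun := fun f => ⟨fun x => f.val (x * g), by
        obtain ⟨⟨U, hU, hf⟩, h⟩ := f.property
        refine ⟨⟨U.comap (MulAut.conj g⁻¹).toMonoidHom, ?_, fun x u hu => ?_⟩,
          fun t u hu x => ?_⟩
        · refine hU.preimage ?_
          show Continuous fun x => g⁻¹ * x * (g⁻¹)⁻¹
          fun_prop
        · have h1 := hf (x * g) (g⁻¹ * u * (g⁻¹)⁻¹) hu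
          have h2 : x * g * (g⁻¹ * u * (g⁻¹)⁻¹) = x * u * g := by group
          rw [h2] at h1
          exact h1
        · have h1 := h t u hu (x * g)
          rw [← mul_assoc] at h1
          exact h1⟩
      map_add' := fun _ _ => rfl
      map_smul' := fun _ _ => rfl }
  map_one' := by
    ext f x
    simp
  map_mul' g h := by
    ext f x
    simp [mul_assoc]

/-- Irreducible smooth representations with a nonzero vector that is fixed by the hyperspecial
maximal compact subgroup. -/
def GroupDatum.IsUnramified (D : GroupDatum k R m r) {V : Type*} [AddCommGroup V] [Module ℂ V]
    (π : Representation ℂ D.group V) : Prop :=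
  π.IsIrreducible ∧ IsSmooth π ∧ ∃ v : V, v ≠ 0 ∧ ∀ g ∈ D.integral, π g v = v

/-- The unramified representation `π` is a constituent of `I(χ)`, where `χ` is the unramified
character of `T` with parameters `α`, that is `χ(t) = ∏ᵢ αᵢ ^ ord(tᵢ)`. -/
def GroupDatum.HasSatakeParameter (D : GroupDatum k R m r) {V : Type*} [AddCommGroup V]
    [Module ℂ V] (π : Representation ℂ D.group V) (α : Fin r → ℂˣ) : Prop :=
  D.IsUnramified π ∧ ∃ χ : D.torus →* ℂˣ,
    (∀ t : D.torus, χ t = ∏ i : Fin r,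
      α i ^ ord R (t.val.val.val (Fin.castLE D.rank_le i) (Fin.castLE D.rank_le i))) ∧
    IsSubquotient π (D.ind χ)

end Topological

end Group

/-! ### The general linear group -/

section GeneralLinear

variable (F : Type*) [Field F]

/-- `GL(N)` over `F`, with the upper triangular Borel subgroup. -/
def gl (N : ℕ) : GroupDatum F F N N where
  group := ⊤
  lie := ⊤
  conj_mem := fun _ _ _ _ => Submodule.mem_top
  block := fun i => i
  rank_le := le_rfl

variable [ValuativeRel F] [TopologicalSpace F] [IsNonarchimedeanLocalField F]

/-- The character `g ↦ |det g| ^ s` of `GL(N)`. -/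
def absDet (N : ℕ) (s : ℝ) : (gl F N).group →* ℂ where
  toFun g := ((normAbs F (Matrix.det g.val.val) ^ s : ℝ) : ℂ)
  map_one' := by simp [normAbs_one]
  map_mul' g h := by
    simp [normAbs_mul, Real.mul_rpow (normAbs_nonneg _) (normAbs_nonneg _)]

end GeneralLinear

/-! ### The classical groups -/

section Classical

/-- The isometry group of the form with Gram matrix `J`, sesquilinear for `c`. -/
def isometryGroup {k R : Type*} [Field k] [Field R] [Algebra k R] {m : ℕ} (c : R ≃ₐ[k] R)
    (J : Matrix (Fin m) (Fin m) R) : Subgroup (GL (Fin m) R) where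
  carrier := {g | (g.val.map c).transpose * J * g.val = J}
  one_mem' := by
    simp [Matrix.map_one]
  mul_mem' := by
    intro g h hg hh
    have hg' : (g.val.map c).transpose * J * g.val = J := hg
    have hh' : (h.val.map c).transpose * J * h.val = J := hh
    show ((g.val * h.val).map c).transpose * J * (g.val * h.val) = J
    rw [Matrix.map_mul, Matrix.transpose_mul]
    calc _ = (h.val.map c).transpose * ((g.val.map c).transpose * J * g.val) * h.val := by
          simp only [Matrix.mul_assoc]
      _ = J := by rw [hg', hh']
  inv_mem' := by
    intro g hg
    have hg' : (g.val.map c).transpose * J * g.val = J := hg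
    show ((g⁻¹).val.map c).transpose * J * (g⁻¹).val = J
    have h1 : ((g⁻¹).val.map c).transpose * (g.val.map c).transpose = 1 := by
      rw [← Matrix.transpose_mul, ← Matrix.map_mul, Units.mul_inv]
      simp [Matrix.map_one]
    calc _ = ((g⁻¹).val.map c).transpose * ((g.val.map c).transpose * J * g.val) * (g⁻¹).val := by
          rw [hg']
      _ = (((g⁻¹).val.map c).transpose * (g.val.map c).transpose) * J *
            (g.val * (g⁻¹).val) := by
          simp only [Matrix.mul_assoc]
      _ = J := by rw [h1, Units.mul_inv, one_mul, mul_one]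

/-- The Lie algebra of the isometry group. -/
def isometryLie {k R : Type*} [Field k] [Field R] [Algebra k R] {m : ℕ} (c : R ≃ₐ[k] R)
    (J : Matrix (Fin m) (Fin m) R) : Submodule k (Matrix (Fin m) (Fin m) R) where
  carrier := {X | (X.map c).transpose * J + J * X = 0}
  zero_mem' := by
    simp [Matrix.map_zero]
  add_mem' := by
    intro X Y hX hY
    have hX' : (X.map c).transpose * J + J * X = 0 := hX
    have hY' : (Y.map c).transpose * J + J * Y = 0 := hY
    show ((X + Y).map c).transpose * J + J * (X + Y) = 0
    rw [Matrix.map_add _ (map_add c), Matrix.transpose_add, add_mul, mul_add]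
    calc _ = ((X.map c).transpose * J + J * X) + ((Y.map c).transpose * J + J * Y) := by abel
      _ = 0 := by rw [hX', hY', add_zero]
  smul_mem' := by
    intro a X hX
    have hX' : (X.map c).transpose * J + J * X = 0 := hX
    show ((a • X).map c).transpose * J + J * (a • X) = 0
    have h1 : (a • X).map c = a • X.map c := by
      ext i j
      simp
    rw [h1, Matrix.transpose_smul, Matrix.smul_mul, Matrix.mul_smul, ← smul_add, hX', smul_zero]

theorem isometryLie_conj_mem {k R : Type*} [Field k] [Field R] [Algebra k R] {m : ℕ}
    (c : R ≃ₐ[k] R) (J : Matrix (Fin m) (Fin m) R) (g : GL (Fin m) R) (hg : g ∈ isometryGroup c J)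
    (X : Matrix (Fin m) (Fin m) R) (hX : X ∈ isometryLie c J) :
    g.val * X * (g⁻¹).val ∈ isometryLie c J := by
  have hX' : (X.map c).transpose * J + J * X = 0 := hX
  have hg1 : (g.val.map c).transpose * J * g.val = J := hg
  have hg2 : ((g⁻¹).val.map c).transpose * J * (g⁻¹).val = J := (isometryGroup c J).inv_mem hg
  have e1 : (g.val.map c).transpose * J = J * (g⁻¹).val := by
    calc _ = (g.val.map c).transpose * J * (g.val * (g⁻¹).val) := by rw [Units.mul_inv, mul_one]
      _ = ((g.val.map c).transpose * J * g.val) * (g⁻¹).val := by simp only [Matrix.mul_assoc]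
      _ = _ := by rw [hg1]
  have e2 : J * g.val = ((g⁻¹).val.map c).transpose * J := by
    calc _ = (((g⁻¹).val.map c).transpose * J * (g⁻¹).val) * g.val := by rw [hg2]
      _ = ((g⁻¹).val.map c).transpose * J * ((g⁻¹).val * g.val) := by
        simp only [Matrix.mul_assoc]
      _ = _ := by rw [Units.inv_mul, mul_one]
  show ((g.val * X * (g⁻¹).val).map c).transpose * J + J * (g.val * X * (g⁻¹).val) = 0
  rw [Matrix.map_mul, Matrix.map_mul, Matrix.transpose_mul, Matrix.transpose_mul]
  calc _ = ((g⁻¹).val.map c).transpose * ((X.map c).transpose * ((g.val.map c).transpose * J)) +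
        (J * g.val) * X * (g⁻¹).val := by simp only [Matrix.mul_assoc]
    _ = ((g⁻¹).val.map c).transpose * ((X.map c).transpose * J + J * X) * (g⁻¹).val := by
        rw [e1, e2, Matrix.mul_add, Matrix.add_mul]
        simp only [Matrix.mul_assoc]
    _ = 0 := by rw [hX', mul_zero, zero_mul]

/-- The matrices of determinant one. -/
def detOne (R : Type*) [Field R] (m : ℕ) : Subgroup (GL (Fin m) R) :=
  (Matrix.GeneralLinearGroup.det : GL (Fin m) R →* Rˣ).ker

/-- Gram matrix of the polar form of `∑_{i<n} xᵢ x_{2n-i} + xₙ²` (indices from `0` to `2n`). -/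
def gramOdd (k : Type*) [Field k] (n : ℕ) : Matrix (Fin (2 * n + 1)) (Fin (2 * n + 1)) k :=
  fun i j => if j = i.rev then (if (i : ℕ) = n then 2 else 1) else 0

/-- Gram matrix of an alternating form of dimension `2n`. -/
def gramSymplectic (k : Type*) [Field k] (n : ℕ) : Matrix (Fin (2 * n)) (Fin (2 * n)) k :=
  fun i j => if j = i.rev then (if (i : ℕ) < n then 1 else -1) else 0

/-- The anti-diagonal matrix with entries `1`: the split Hermitian form, and the polar form of the
split quadratic form `∑_{i<n} xᵢ x_{2n-1-i}` if `m = 2n`. -/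
def gramSplit (R : Type*) [Field R] (m : ℕ) : Matrix (Fin m) (Fin m) R :=
  fun i j => if j = i.rev then 1 else 0

/-- Gram matrix of the polar form of
`∑_{i<n-1} xᵢ x_{2n-1-i} + (x_{n-1}² + a x_{n-1} x_n + b x_n²)` (indices from `0` to `2n-1`). -/
def gramNonsplit (k : Type*) [Field k] (n : ℕ) (a b : k) : Matrix (Fin (2 * n)) (Fin (2 * n)) k :=
  fun i j =>
    if (i : ℕ) + 1 = n ∧ j = i then 2
    else if (i : ℕ) = n ∧ j = i then 2 * b
    else if j = i.rev then (if (i : ℕ) + 1 = n ∨ (i : ℕ) = n then a else 1)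
    else 0

/-- Split `SO(2n+1)`. -/
def soOdd (k : Type*) [Field k] (n : ℕ) : GroupDatum k k (2 * n + 1) n where
  group := isometryGroup (AlgEquiv.refl : k ≃ₐ[k] k) (gramOdd k n) ⊓ detOne k (2 * n + 1)
  lie := isometryLie (AlgEquiv.refl : k ≃ₐ[k] k) (gramOdd k n)
  conj_mem := fun g hg => isometryLie_conj_mem _ _ g hg.1
  block := fun i => i
  rank_le := by omega

/-- `Sp(2n)`. -/
def sp (k : Type*) [Field k] (n : ℕ) : GroupDatum k k (2 * n) n where
  group := isometryGroup (AlgEquiv.refl : k ≃ₐ[k] k) (gramSymplectic k n)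
  lie := isometryLie (AlgEquiv.refl : k ≃ₐ[k] k) (gramSymplectic k n)
  conj_mem := isometryLie_conj_mem _ _
  block := fun i => i
  rank_le := by omega

/-- The quasi-split unitary group `U(n)` of an extension `R / k` with conjugation `c`. -/
def unitaryU {k R : Type*} [Field k] [Field R] [Algebra k R] (c : R ≃ₐ[k] R) (n : ℕ) :
    GroupDatum k R n (n / 2) where
  group := isometryGroup c (gramSplit R n)
  lie := isometryLie c (gramSplit R n)
  conj_mem := isometryLie_conj_mem _ _
  block := fun i => i
  rank_le := Nat.div_le_self n 2

/-- Split `SO(2n)`. -/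
def soEvenSplit (k : Type*) [Field k] (n : ℕ) : GroupDatum k k (2 * n) n where
  group := isometryGroup (AlgEquiv.refl : k ≃ₐ[k] k) (gramSplit k (2 * n)) ⊓ detOne k (2 * n)
  lie := isometryLie (AlgEquiv.refl : k ≃ₐ[k] k) (gramSplit k (2 * n))
  conj_mem := fun g hg => isometryLie_conj_mem _ _ g hg.1
  block := fun i => i
  rank_le := by omega

/-- The quasi-split group `SO(2n)` whose anisotropic kernel is the special orthogonal group of the
binary form `x² + a x y + b y²`; its two middle basis vectors form one block. -/
def soEvenNonsplit (k : Type*) [Field k] (n : ℕ) (a b : k) : GroupDatum k k (2 * n) (n - 1) where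
  group := isometryGroup (AlgEquiv.refl : k ≃ₐ[k] k) (gramNonsplit k n a b) ⊓ detOne k (2 * n)
  lie := isometryLie (AlgEquiv.refl : k ≃ₐ[k] k) (gramNonsplit k n a b)
  conj_mem := fun g hg => isometryLie_conj_mem _ _ g hg.1
  block := fun i => if (i : ℕ) = n then n - 1 else i
  rank_le := by omega

end Classical

/-! ### Functorial transfer -/

section Transfer

/-- `diag(α₁, …, α_r, 1, …, 1, α_r⁻¹, …, α₁⁻¹)` of size `N`. -/
def dualTorus {r : ℕ} (N : ℕ) (α : Fin r → ℂˣ) : Matrix (Fin N) (Fin N) ℂ :=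
  Matrix.diagonal fun i =>
    if h : (i : ℕ) < r then (α ⟨i, h⟩ : ℂ)
    else if h' : (i.rev : ℕ) < r then ((α ⟨i.rev, h'⟩)⁻¹ : ℂˣ) else 1

/-- The element of `O(2n, ℂ)` that exchanges the two middle basis vectors: the image of Frobenius
under the standard representation of the L-group of a nonsplit `SO(2n)`. -/
def frobeniusSwap (n : ℕ) : Matrix (Fin (2 * n)) (Fin (2 * n)) ℂ :=
  fun i j =>
    if (i : ℕ) + 1 = n ∨ (i : ℕ) = n then (if j = i.rev then 1 else 0)
    else (if j = i then 1 else 0)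

/-- The matrix `diag(α₁, …, α_r, 1, …, 1)` of size `n`, an element of the dual group of `U(n)`. -/
def halfTorus {r : ℕ} (n : ℕ) (α : Fin r → ℂˣ) : Matrix (Fin n) (Fin n) ℂ :=
  Matrix.diagonal fun i => if h : (i : ℕ) < r then (α ⟨i, h⟩ : ℂ) else 1

/-- The action `t ↦ w ᵗt⁻¹ w⁻¹` of the Frobenius of `k` on the diagonal torus of the dual group
`GL(n, ℂ)` of `U(n)`; here `w` is anti-diagonal with entries `±1`, whose signs do not affect the
action on diagonal matrices. -/
def unitaryFrobenius (n : ℕ) (t : Matrix (Fin n) (Fin n) ℂ) : Matrix (Fin n) (Fin n) ℂ :=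
  gramSplit ℂ n * (t⁻¹).transpose * (gramSplit ℂ n)⁻¹

variable {k R : Type*} [Field k] [ValuativeRel k] [TopologicalSpace k]
  [IsNonarchimedeanLocalField k] [Field R] [ValuativeRel R] [TopologicalSpace R]
  [IsNonarchimedeanLocalField R] [Algebra k R] {m r : ℕ}

/-- Functorial transfer of unramified representations to `GL(N, R)` along a homomorphism of
L-groups which maps the Satake parameter `α` to the element `L α` of `GL(N, ℂ)`: the Satake
parameter of `Π` is the conjugacy class of `L α`, for a Satake parameter `α` of `π`. -/
def IsTransfer (D : GroupDatum k R m r) {N : ℕ} (L : (Fin r → ℂˣ) → Matrix (Fin N) (Fin N) ℂ)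
    {V W : Type*} [AddCommGroup V] [Module ℂ V] [AddCommGroup W] [Module ℂ W]
    (π : Representation ℂ D.group V) (Pi : Representation ℂ (gl R N).group W) : Prop :=
  ∃ (α : Fin r → ℂˣ) (β : Fin N → ℂˣ),
    D.HasSatakeParameter π α ∧ (gl R N).HasSatakeParameter Pi β ∧
    ∃ P : GL (Fin N) ℂ, P.val * L α * (P⁻¹).val = Matrix.diagonal fun i => (β i : ℂ)

/-- Dual group `Sp(2n, ℂ)`. -/
def transferSOOdd (k : Type*) [Field k] [ValuativeRel k] [TopologicalSpace k]
    [IsNonarchimedeanLocalField k] (n : ℕ) {V W : Type*} [AddCommGroup V] [Module ℂ V]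
    [AddCommGroup W] [Module ℂ W] (π : Representation ℂ (soOdd k n).group V)
    (Pi : Representation ℂ (gl k (2 * n)).group W) : Prop :=
  IsTransfer (soOdd k n) (dualTorus (2 * n)) π Pi

/-- Dual group `SO(2n+1, ℂ)`. -/
def transferSp (k : Type*) [Field k] [ValuativeRel k] [TopologicalSpace k]
    [IsNonarchimedeanLocalField k] (n : ℕ) {V W : Type*} [AddCommGroup V] [Module ℂ V]
    [AddCommGroup W] [Module ℂ W] (π : Representation ℂ (sp k n).group V)
    (Pi : Representation ℂ (gl k (2 * n + 1)).group W) : Prop :=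
  IsTransfer (sp k n) (dualTorus (2 * n + 1)) π Pi

/-- Standard base change to `GL(n)` over the quadratic extension `R`: the Frobenius of `R` is the
square of the Frobenius of `k`, so that the Satake parameter `t ⋊ Frob` is sent to
`t · Frob(t)`. -/
def transferUnitary (c : R ≃ₐ[k] R) (n : ℕ) {V W : Type*} [AddCommGroup V] [Module ℂ V]
    [AddCommGroup W] [Module ℂ W] (π : Representation ℂ (unitaryU c n).group V)
    (Pi : Representation ℂ (gl R n).group W) : Prop :=
  IsTransfer (unitaryU c n) (fun α => halfTorus n α * unitaryFrobenius n (halfTorus n α)) π Pi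

/-- Dual group `SO(2n, ℂ)`. -/
def transferSOEvenSplit (k : Type*) [Field k] [ValuativeRel k] [TopologicalSpace k]
    [IsNonarchimedeanLocalField k] (n : ℕ) {V W : Type*} [AddCommGroup V] [Module ℂ V]
    [AddCommGroup W] [Module ℂ W] (π : Representation ℂ (soEvenSplit k n).group V)
    (Pi : Representation ℂ (gl k (2 * n)).group W) : Prop :=
  IsTransfer (soEvenSplit k n) (dualTorus (2 * n)) π Pi

/-- Dual group `SO(2n, ℂ)`, on which Frobenius acts through an element of `O(2n, ℂ)`. -/
def transferSOEvenNonsplit (k : Type*) [Field k] [ValuativeRel k] [TopologicalSpace k]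
    [IsNonarchimedeanLocalField k] (n : ℕ) (a b : k) {V W : Type*} [AddCommGroup V] [Module ℂ V]
    [AddCommGroup W] [Module ℂ W] (π : Representation ℂ (soEvenNonsplit k n a b).group V)
    (Pi : Representation ℂ (gl k (2 * n)).group W) : Prop :=
  IsTransfer (soEvenNonsplit k n a b) (fun α => dualTorus (2 * n) α * frobeniusSwap n) π Pi

end Transfer

end UnramTransfer

end

open UnramTransfer

noncomputable section

namespace UnramTransfer

/-! Conjugation by σ would commute with everything in sight except for the square root in normalized
induction. Write σ(√q) = ε√q with ε = ±1. Then f ↦ σ ∘ f carries I(χ) semilinearly onto I(χ'), where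
χ' = σ(χ) · σ(δ^{1/2})/δ^{1/2}, and the last quotient is t ↦ ε^{ord det(Ad t | Lie N)}
(`GroupDatum.map_sqrt_modulus`). So a Satake parameter α becomes σ(α) up to a sign that depends only
on the parity of ord det Ad(t).

These parities come from explicit coordinates on the nilradical (`gl_det_Ad`,
`GroupDatum.IsQuasiSplit.det_Ad`) and a degree count on pairs of indices (`even_sum_sub_sum`).
Modulo 2, ord det Ad(t) is (N-1) ∑ ord tᵢ for GL(N), ∑ᵢ ord tᵢ over the first n entries for
SO(2n+1), and 0 for Sp(2n) and SO(2n). For U(n) it is 0 because the determinant is a product of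
norms from an unramified quadratic extension (`even_ord_norm`).

It remains to match signs. For SO(2n+1) both sides acquire ε, and L(εα) = εL(α). For Sp(2n) and
GL(2n+1) neither side acquires a sign. For U(n) the group has none, and GL(n, E) has none because
the residue field of E has q² elements and √(q²) = q is rational. For SO(2n) the group has no sign
but GL(2n) has ε; the twists by |det|^{±1/2} compensate, since σ(|det|^{1/2}) = ε^{ord det}
|det|^{1/2}.

To treat all cases at once, `TwistedEquiv` allows an unramified character η of the group besides
semilinearity. The abstract comparison is `isTransfer_iff`; `GroupDatum.IsConjDatum` collects what
it needs to know about a group. -/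

/-! ### Semilinear equivalences of representations up to a character -/

section TwistedEquiv

variable {G V V' W W' : Type*} [Group G] [AddCommGroup V] [Module ℂ V] [AddCommGroup V']
  [Module ℂ V'] [AddCommGroup W] [Module ℂ W] [AddCommGroup W'] [Module ℂ W']

/-- A bijection `V ≃ V'` that is semilinear for `σ` and identifies `ρ` with `η ⊗ ρ'`. -/
structure TwistedEquiv (σ : ℂ ≃+* ℂ) (η : G →* ℂˣ) (ρ : Representation ℂ G V)
    (ρ' : Representation ℂ G V') where
  /-- the underlying additive equivalence -/
  toAddEquiv : V ≃+ V'
  map_smul : ∀ (c : ℂ) (v : V), toAddEquiv (c • v) = σ c • toAddEquiv v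
  map_rep : ∀ (g : G) (v : V), toAddEquiv (ρ g v) = (η g : ℂ) • ρ' g (toAddEquiv v)

namespace TwistedEquiv

variable {σ : ℂ ≃+* ℂ} {η : G →* ℂˣ} {ρ : Representation ℂ G V} {ρ' : Representation ℂ G V'}
  {τ : Representation ℂ G W} {τ' : Representation ℂ G W'}

theorem symm_smul (e : TwistedEquiv σ η ρ ρ') (c : ℂ) (v : V') :
    e.toAddEquiv.symm (c • v) = σ.symm c • e.toAddEquiv.symm v := by
  rw [AddEquiv.symm_apply_eq, e.map_smul]
  simp

theorem rep_apply (e : TwistedEquiv σ η ρ ρ') (g : G) (v : V) :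
    ρ' g (e.toAddEquiv v) = (η g : ℂ)⁻¹ • e.toAddEquiv (ρ g v) := by
  rw [e.map_rep, smul_smul, inv_mul_cancel₀ (η g).ne_zero, one_smul]

theorem symm_rep (e : TwistedEquiv σ η ρ ρ') (g : G) (v : V') :
    e.toAddEquiv.symm (ρ' g v) = σ.symm (η g : ℂ)⁻¹ • ρ g (e.toAddEquiv.symm v) := by
  obtain ⟨v, rfl⟩ := e.toAddEquiv.surjective v
  rw [e.rep_apply, e.symm_smul, AddEquiv.symm_apply_apply, AddEquiv.symm_apply_apply]

/-- The inverse, which is semilinear for `σ⁻¹`. -/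
def symm (e : TwistedEquiv σ η ρ ρ') (η' : G →* ℂˣ) (h : ∀ g, σ (η' g) = (η g : ℂ)⁻¹) :
    TwistedEquiv σ.symm η' ρ' ρ where
  toAddEquiv := e.toAddEquiv.symm
  map_smul := e.symm_smul
  map_rep g v := by
    rw [e.symm_rep, ← h, RingEquiv.symm_apply_apply]

/-- The image of a subrepresentation. -/
def mapSub (e : TwistedEquiv σ η ρ ρ') (S : Subrepresentation ρ) : Subrepresentation ρ' where
  toSubmodule :=
    { carrier := {v | e.toAddEquiv.symm v ∈ S.toSubmodule}
      zero_mem' := by simp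
      add_mem' := fun {v w} hv hw => by
        simpa using S.toSubmodule.add_mem hv hw
      smul_mem' := fun c v hv => by
        simpa [e.symm_smul] using S.toSubmodule.smul_mem (σ.symm c) hv }
  apply_mem_toSubmodule g v hv := by
    show e.toAddEquiv.symm (ρ' g v) ∈ S.toSubmodule
    rw [e.symm_rep]
    exact S.toSubmodule.smul_mem _ (S.apply_mem_toSubmodule g hv)

theorem mem_mapSub (e : TwistedEquiv σ η ρ ρ') (S : Subrepresentation ρ) (v : V') :
    v ∈ (e.mapSub S).toSubmodule ↔ e.toAddEquiv.symm v ∈ S.toSubmodule := Iff.rfl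

/-- Every η thus admits a character as required by `symm`, namely σ⁻¹ ∘ η⁻¹. -/
theorem inverse_character (η : G →* ℂˣ) (σ : ℂ ≃+* ℂ) (g : G) :
    σ (((Units.map (σ.symm : ℂ →* ℂ)).comp η⁻¹ g : ℂˣ) : ℂ) = (η g : ℂ)⁻¹ := by
  simp

/-- The lattices of subrepresentations are isomorphic. -/
def subrepOrderIso (e : TwistedEquiv σ η ρ ρ') :
    Subrepresentation ρ ≃o Subrepresentation ρ' where
  toFun := e.mapSub
  invFun := (e.symm _ (inverse_character η σ)).mapSub
  left_inv S := by
    apply Subrepresentation.toSubmodule_injective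
    ext v
    simp [mem_mapSub, symm]
  right_inv S := by
    apply Subrepresentation.toSubmodule_injective
    ext v
    simp [mem_mapSub, symm]
  map_rel_iff' {S T} := by
    constructor
    · intro h v hv
      have := h (show e.toAddEquiv v ∈ e.mapSub S from by
        show e.toAddEquiv.symm (e.toAddEquiv v) ∈ S.toSubmodule
        rw [AddEquiv.symm_apply_apply]
        exact hv)
      have h2 : e.toAddEquiv.symm (e.toAddEquiv v) ∈ T.toSubmodule := this
      rw [AddEquiv.symm_apply_apply] at h2
      exact h2
    · intro h v hv
      exact h hv

/-- Irreducibility is simplicity of the lattice of subrepresentations, which sees neither σ nor η.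
-/
theorem isIrreducible (e : TwistedEquiv σ η ρ ρ') (h : ρ.IsIrreducible) : ρ'.IsIrreducible :=
  e.subrepOrderIso.isSimpleOrder_iff.mp h

/-- The new quotient map is e ∘ q ∘ f⁻¹. It is linear because the semilinearities of e and f⁻¹
cancel, and equivariant because both equivalences involve the same η. -/
theorem isSubquotient (e : TwistedEquiv σ η ρ ρ') (f : TwistedEquiv σ η τ τ')
    (h : IsSubquotient ρ τ) : IsSubquotient ρ' τ' := by
  obtain ⟨S, q, hq⟩ := h
  refine ⟨f.mapSub S, ⟨{
    toFun := fun w => e.toAddEquiv (q ⟨f.toAddEquiv.symm w.val, w.property⟩)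
    map_add' := fun w w' => ?_
    map_smul' := fun c w => ?_ }, fun g => ?_⟩, fun v => ?_⟩
  · rw [← map_add, ← map_add]
    congr 2
    ext
    simp
  · rw [RingHom.id_apply, show c = σ (σ.symm c) by simp, ← e.map_smul, ← _root_.map_smul]
    congr 2
    ext
    simp [f.symm_smul]
  · ext w
    show e.toAddEquiv (q ⟨f.toAddEquiv.symm (τ' g w.val), _⟩) =
      ρ' g (e.toAddEquiv (q ⟨f.toAddEquiv.symm w.val, w.property⟩))
    rw [e.rep_apply, ← q.isIntertwining, show (η g : ℂ)⁻¹ = σ (σ.symm (η g : ℂ)⁻¹) by simp,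
      ← e.map_smul, ← _root_.map_smul]
    congr 2
    ext
    exact f.symm_rep g w.val
  · obtain ⟨s, hs⟩ := hq (e.toAddEquiv.symm v)
    refine ⟨⟨f.toAddEquiv s.val, ?_⟩, ?_⟩
    · rw [mem_mapSub]
      simp
    · show e.toAddEquiv (q ⟨f.toAddEquiv.symm (f.toAddEquiv s.val), _⟩) = v
      simp [hs]

/-- The stabilizer of the image of v contains Stab(v) ∩ ker η, an open neighbourhood of 1, and a
subgroup containing such a neighbourhood is open. -/
theorem isSmooth [TopologicalSpace G] [IsTopologicalGroup G] (e : TwistedEquiv σ η ρ ρ')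
    (hη : IsOpen {g | η g = 1}) (h : IsSmooth ρ) : IsSmooth ρ' := by
  intro v
  obtain ⟨v, rfl⟩ := e.toAddEquiv.surjective v
  let S : Subgroup G :=
    { carrier := {g | ρ' g (e.toAddEquiv v) = e.toAddEquiv v}
      one_mem' := by simp
      mul_mem' := fun {a b} ha hb => by
        have ha' : ρ' a (e.toAddEquiv v) = e.toAddEquiv v := ha
        have hb' : ρ' b (e.toAddEquiv v) = e.toAddEquiv v := hb
        show ρ' (a * b) _ = _
        rw [map_mul, Module.End.mul_apply, hb', ha']
      inv_mem' := fun {a} ha => by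
        have ha' : ρ' a (e.toAddEquiv v) = e.toAddEquiv v := ha
        show ρ' a⁻¹ _ = _
        conv_lhs => rw [← ha']
        exact Representation.inv_self_apply ρ' a _ }
  refine S.isOpen_of_mem_nhds (g := 1) (Filter.mem_of_superset
    (((h v).inter hη).mem_nhds ⟨by simp, by simp⟩) ?_)
  rintro g ⟨hg, hg'⟩
  show ρ' g (e.toAddEquiv v) = e.toAddEquiv v
  have hg1 : ρ g v = v := hg
  have hg2 : η g = 1 := hg'
  rw [e.rep_apply, hg1, hg2]
  simp

/-- The identity of `V`, as an equivalence of `ρ` with its conjugate. -/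
def conj (σ : ℂ ≃+* ℂ) (ρ : Representation ℂ G V) : TwistedEquiv σ 1 ρ (conjRep σ ρ) where
  toAddEquiv := AddEquiv.refl V
  map_smul c v := by
    show c • v = σ.symm (σ c) • v
    rw [RingEquiv.symm_apply_apply]
  map_rep g v := by
    rw [MonoidHom.one_apply, Units.val_one, one_smul]
    rfl

end TwistedEquiv

end TwistedEquiv

/-! ### Conjugation of principal series and Satake parameters -/

section Satake

variable {k R : Type*} [Field k] [Field R] [Algebra k R] {m r : ℕ}

/-- The basis vectors that carry the coordinates of the torus form blocks of size one. -/
def GroupDatum.HasSingletonBlocks (D : GroupDatum k R m r) : Prop :=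
  ∀ (i : Fin r) (j : Fin m), D.block j = D.block (Fin.castLE D.rank_le i) →
    j = Fin.castLE D.rank_le i

/-- When i is a block of its own, row i of a torus element vanishes off the diagonal, so the i-th
diagonal entry is multiplicative. -/
theorem GroupDatum.torus_mul_diag (D : GroupDatum k R m r) {i : Fin m}
    (hi : ∀ j, D.block j = D.block i → j = i) (s t : D.torus) :
    (s * t).val.val.val i i = s.val.val.val i i * t.val.val.val i i := by
  show (s.val.val.val * t.val.val.val) i i = _
  rw [Matrix.mul_apply]
  refine Finset.sum_eq_single i (fun l _ hl => ?_) (by simp)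
  rw [(s.property i l fun h => hl (hi l h.symm)).1, zero_mul]

theorem GroupDatum.torus_diag_mul_inv (D : GroupDatum k R m r) {i : Fin m}
    (hi : ∀ j, D.block j = D.block i → j = i) (t : D.torus) :
    t.val.val.val i i * (t⁻¹).val.val.val i i = 1 := by
  rw [← D.torus_mul_diag hi, mul_inv_cancel]
  show (1 : Matrix (Fin m) (Fin m) R) i i = 1
  simp

theorem GroupDatum.torus_diag_ne_zero (D : GroupDatum k R m r) {i : Fin m}
    (hi : ∀ j, D.block j = D.block i → j = i) (t : D.torus) : t.val.val.val i i ≠ 0 :=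
  left_ne_zero_of_mul_eq_one (D.torus_diag_mul_inv hi t)

variable [ValuativeRel R] [TopologicalSpace R] [IsNonarchimedeanLocalField R]

/-- The unramified character of the torus with parameters `α`. -/
def GroupDatum.unramifiedCharacter (D : GroupDatum k R m r) (hD : D.HasSingletonBlocks)
    (α : Fin r → ℂˣ) : D.torus →* ℂˣ where
  toFun t := ∏ i : Fin r,
    α i ^ ord R (t.val.val.val (Fin.castLE D.rank_le i) (Fin.castLE D.rank_le i))
  map_one' := by
    refine Finset.prod_eq_one fun i _ => ?_
    show α i ^ ord R ((1 : Matrix (Fin m) (Fin m) R) _ _) = 1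
    simp [ord_one]
  map_mul' s t := by
    rw [← Finset.prod_mul_distrib]
    refine Finset.prod_congr rfl fun i _ => ?_
    rw [D.torus_mul_diag (hD i), ord_mul (D.torus_diag_ne_zero (hD i) s)
      (D.torus_diag_ne_zero (hD i) t), zpow_add]

variable {V V' : Type*} [AddCommGroup V] [Module ℂ V] [AddCommGroup V'] [Module ℂ V']

theorem GroupDatum.IsUnramified.of_twistedEquiv {D : GroupDatum k R m r} {σ : ℂ ≃+* ℂ}
    {η : D.group →* ℂˣ} {π : Representation ℂ D.group V} {π' : Representation ℂ D.group V'}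
    (e : TwistedEquiv σ η π π') (hη : IsOpen {g | η g = 1}) (hint : ∀ g ∈ D.integral, η g = 1)
    (h : D.IsUnramified π) : D.IsUnramified π' := by
  obtain ⟨h1, h2, v, hv, hv'⟩ := h
  refine ⟨e.isIrreducible h1, e.isSmooth hη h2, e.toAddEquiv v, by simpa using hv, fun g hg => ?_⟩
  rw [e.rep_apply, hint g hg, hv' g hg]
  simp

variable [ValuativeRel k] [TopologicalSpace k] [IsNonarchimedeanLocalField k]

/-- Conjugation by `σ` and multiplication by `η⁻¹` identify two principal series. -/
def GroupDatum.indEquiv (D : GroupDatum k R m r) (σ : ℂ ≃+* ℂ) (η : D.group →* ℂˣ)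
    (hη : IsOpen {g | η g = 1}) (hu : ∀ u ∈ D.unipotent, η u = 1) (χ χ' : D.torus →* ℂˣ)
    (h : ∀ t : D.torus, σ (χ t * (Real.sqrt (D.modulus t) : ℂ)) =
      η t.val * (χ' t * (Real.sqrt (D.modulus t) : ℂ))) :
    TwistedEquiv σ η (D.ind χ) (D.ind χ') where
  toAddEquiv :=
    -- Division by η absorbs the part of σ(δ^{1/2})/δ^{1/2} that extends to the group; `h` says that
    -- χ' accounts for the rest. Right invariance survives only on U ∩ ker η, hence the openness of
    -- ker η.
    { toFun := fun f => ⟨fun g => (η g : ℂ)⁻¹ * σ (f.val g), by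
        obtain ⟨⟨U, hU, hf⟩, hf'⟩ := f.property
        refine ⟨⟨U ⊓ η.ker, hU.inter hη, fun g u hgu => ?_⟩, fun t u hgu g => ?_⟩
        · dsimp only
          rw [hf g u hgu.1, map_mul η, show η u = 1 from hgu.2, mul_one]
        · dsimp only
          rw [hf' t u hgu g, map_mul σ, h t, map_mul, map_mul, hu u hgu]
          push_cast
          field_simp⟩
      invFun := fun f => ⟨fun g => σ.symm (η g * f.val g), by
        obtain ⟨⟨U, hU, hf⟩, hf'⟩ := f.property
        refine ⟨⟨U ⊓ η.ker, hU.inter hη, fun g u hgu => ?_⟩, fun t u hgu g => ?_⟩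
        · dsimp only
          rw [hf g u hgu.1, map_mul η, show η u = 1 from hgu.2, mul_one]
        · dsimp only
          rw [RingEquiv.symm_apply_eq, hf' t u hgu g, map_mul σ, h t, map_mul, map_mul, hu u hgu,
            RingEquiv.apply_symm_apply]
          push_cast
          ring⟩
      left_inv := fun f => by
        ext g
        simp
      right_inv := fun f => by
        ext g
        simp
      map_add' := fun f f' => by
        ext g
        simp [mul_add] }
  map_smul c f := by
    ext g
    show (η g : ℂ)⁻¹ * σ (c * f.val g) = σ c * ((η g : ℂ)⁻¹ * σ (f.val g))
    rw [map_mul]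
    ring
  map_rep g f := by
    ext x
    show (η x : ℂ)⁻¹ * σ (f.val (x * g)) = η g * ((η (x * g) : ℂ)⁻¹ * σ (f.val (x * g)))
    rw [map_mul]
    push_cast
    field_simp

/-- The conjugate lies in I(ψ · σ(χ)), with ψ the unramified character all of whose parameters are
ε. This is where the sign enters the Satake parameter. -/
theorem GroupDatum.HasSatakeParameter.of_twistedEquiv {D : GroupDatum k R m r}
    (hD : D.HasSingletonBlocks) {σ : ℂ ≃+* ℂ}
    {η : D.group →* ℂˣ} {π : Representation ℂ D.group V} {π' : Representation ℂ D.group V'}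
    (e : TwistedEquiv σ η π π') (hη : IsOpen {g | η g = 1}) (hint : ∀ g ∈ D.integral, η g = 1)
    (hu : ∀ u ∈ D.unipotent, η u = 1) {ε : ℂˣ}
    (hε : ∀ t : D.torus, σ (Real.sqrt (D.modulus t) : ℂ) =
      η t.val * (D.unramifiedCharacter hD (fun _ => ε) t * (Real.sqrt (D.modulus t) : ℂ)))
    {α : Fin r → ℂˣ} (h : D.HasSatakeParameter π α) :
    D.HasSatakeParameter π' (fun i => ε * Units.map (σ : ℂ →* ℂ) (α i)) := by
  obtain ⟨h1, χ, hχ, h2⟩ := h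
  refine ⟨h1.of_twistedEquiv e hη hint,
    D.unramifiedCharacter hD (fun _ => ε) * (Units.map (σ : ℂ →* ℂ)).comp χ, fun t => ?_,
    e.isSubquotient (D.indEquiv σ η hη hu _ _ fun t => ?_) h2⟩
  · rw [MonoidHom.mul_apply, MonoidHom.comp_apply, hχ, map_prod]
    show (∏ i : Fin r, _) * _ = _
    rw [← Finset.prod_mul_distrib]
    refine Finset.prod_congr rfl fun i _ => ?_
    rw [mul_zpow, map_zpow]
  · rw [map_mul, hε]
    simp only [MonoidHom.mul_apply, MonoidHom.comp_apply, Units.val_mul, Units.coe_map,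
      MonoidHom.coe_coe]
    ring

end Satake

/-! ### The square root of the modulus character -/

section Ord

variable {F : Type*} [Field F] [ValuativeRel F] [TopologicalSpace F] [IsNonarchimedeanLocalField F]

theorem ord_inv {x : F} (hx : x ≠ 0) : ord F x⁻¹ = -ord F x := by
  have h := ord_mul hx (inv_ne_zero hx)
  rw [mul_inv_cancel₀ hx, ord_one] at h
  omega

theorem ord_div {x y : F} (hx : x ≠ 0) (hy : y ≠ 0) : ord F (x / y) = ord F x - ord F y := by
  rw [div_eq_mul_inv, ord_mul hx (inv_ne_zero hy), ord_inv hy, sub_eq_add_neg]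

theorem ord_pow {x : F} (hx : x ≠ 0) (n : ℕ) : ord F (x ^ n) = n * ord F x := by
  induction n with
  | zero => simp [ord_one]
  | succ n ih =>
    rw [pow_succ, ord_mul (pow_ne_zero n hx) hx, ih]
    push_cast
    ring

theorem ord_prod {ι : Type*} (s : Finset ι) (f : ι → F) (hf : ∀ i ∈ s, f i ≠ 0) :
    ord F (∏ i ∈ s, f i) = ∑ i ∈ s, ord F (f i) := by
  classical
  induction s using Finset.induction_on with
  | empty => simp [ord_one]
  | insert a s ha ih =>
    rw [Finset.prod_insert ha, Finset.sum_insert ha, ord_mul (hf a (by simp))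
      (Finset.prod_ne_zero_iff.mpr fun i hi => hf i (by simp [hi])),
      ih fun i hi => hf i (by simp [hi])]

theorem ord_nonneg_iff {x : F} (hx : x ≠ 0) : 0 ≤ ord F x ↔ x ∈ 𝒪[F] := by
  have h0 : IsNonarchimedeanLocalField.valueGroupWithZeroIsoInt F (valuation F x) ≠ 0 := by
    simpa using hx
  rw [ord, neg_nonneg, ← WithZero.log_one, WithZero.log_le_log h0 one_ne_zero,
    ← map_one (IsNonarchimedeanLocalField.valueGroupWithZeroIsoInt F), map_le_map_iff]
  rfl

theorem ord_eq_zero_of_integral {x y : F} (hx : x ∈ 𝒪[F]) (hy : y ∈ 𝒪[F]) (h : x * y = 1) :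
    ord F x = 0 := by
  have hx0 := left_ne_zero_of_mul_eq_one h
  have hy0 := right_ne_zero_of_mul_eq_one h
  have h1 := (ord_nonneg_iff hx0).mpr hx
  have h2 := (ord_nonneg_iff hy0).mpr hy
  have h3 := ord_mul hx0 hy0
  rw [h, ord_one] at h3
  omega

theorem normAbs_of_ne_zero {x : F} (hx : x ≠ 0) :
    normAbs F x = (Nat.card 𝓀[F] : ℝ) ^ (-ord F x) := by
  simp [normAbs, hx]

end Ord

/-! ### The sign of σ on √q -/

section Sign

/-- `σ(√q) = ± √q`. -/
theorem exists_sign (σ : ℂ ≃+* ℂ) {q : ℕ} (hq : q ≠ 0) :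
    ∃ ε : ℂˣ, ε ^ 2 = 1 ∧ σ (Real.sqrt q : ℂ) = ε * (Real.sqrt q : ℂ) := by
  have h1 : (Real.sqrt q : ℂ) ^ 2 = q := by
    rw [← Complex.ofReal_pow, Real.sq_sqrt (by positivity)]
    simp
  have h2 : σ (Real.sqrt q : ℂ) ^ 2 = (Real.sqrt q : ℂ) ^ 2 := by
    rw [← map_pow, h1, map_natCast]
  rcases sq_eq_sq_iff_eq_or_eq_neg.mp h2 with h | h
  · exact ⟨1, by simp, by simp [h]⟩
  · exact ⟨-1, by simp, by simp [h]⟩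

/-- As σ fixes ±1, the same ε serves for σ and σ⁻¹; this is what makes the converse implications
available. -/
theorem sign_symm {σ : ℂ ≃+* ℂ} {ε : ℂˣ} (hε : ε ^ 2 = 1) {x : ℂ} (h : σ x = ε * x) :
    σ.symm x = ε * x := by
  rw [RingEquiv.symm_apply_eq, map_mul, h, ← mul_assoc]
  have h2 : (ε : ℂ) * ε = 1 := by
    rw [← sq, ← Units.val_pow_eq_pow_val, hε, Units.val_one]
  rcases mul_self_eq_one_iff.mp h2 with h | h <;> simp [h]

theorem sign_zpow_eq_one {ε : ℂˣ} (hε : ε ^ 2 = 1) {a : ℤ} (h : Even a) : ε ^ a = 1 := by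
  obtain ⟨b, rfl⟩ := h
  rw [← two_mul, zpow_mul]
  norm_cast
  rw [hε, one_zpow]

theorem sign_zpow_congr {ε : ℂˣ} (hε : ε ^ 2 = 1) {a b : ℤ} (h : Even (a - b)) :
    ε ^ a = ε ^ b := by
  have := sign_zpow_eq_one hε h
  rwa [zpow_sub, mul_inv_eq_one] at this

/-- √(q^{-a}) = (√q)^{-a}, and ε^{-a} = ε^a because ε² = 1. -/
theorem map_sqrt_zpow {σ : ℂ ≃+* ℂ} {q : ℕ} {ε : ℂˣ} (hε : ε ^ 2 = 1)
    (h : σ (Real.sqrt q : ℂ) = ε * (Real.sqrt q : ℂ)) (a : ℤ) :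
    σ (Real.sqrt ((q : ℝ) ^ (-a)) : ℂ) = (ε ^ a : ℂˣ) * (Real.sqrt ((q : ℝ) ^ (-a)) : ℂ) := by
  have h1 : Real.sqrt ((q : ℝ) ^ (-a)) = Real.sqrt q ^ (-a) := by
    rw [Real.sqrt_eq_iff_mul_self_eq (by positivity) (by positivity), ← mul_zpow,
      Real.mul_self_sqrt (by positivity)]
  rw [h1, Complex.ofReal_zpow, map_zpow₀, h, mul_zpow, ← Units.val_zpow_eq_zpow_val,
    sign_zpow_congr hε (a := -a) (b := a) ⟨-a, by ring⟩]

end Sign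

section Modulus

variable {k R : Type*} [Field k] [Field R] [Algebra k R] {m r : ℕ}

theorem GroupDatum.det_Ad_ne_zero (D : GroupDatum k R m r) (t : D.torus) :
    LinearMap.det (D.Ad t) ≠ 0 := by
  have h : D.Ad t ∘ₗ D.Ad t⁻¹ = LinearMap.id := by
    ext1 X
    apply Subtype.ext
    show t.val.val.val * ((t⁻¹).val.val.val * X.val * ((t⁻¹)⁻¹).val.val.val) *
      (t⁻¹).val.val.val = X.val
    have h1 : t.val.val.val * (t⁻¹).val.val.val = 1 := t.val.val.mul_inv
    rw [inv_inv]
    calc _ = (t.val.val.val * (t⁻¹).val.val.val) * X.val *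
          (t.val.val.val * (t⁻¹).val.val.val) := by simp only [Matrix.mul_assoc]
      _ = X.val := by rw [h1, one_mul, mul_one]
  have h2 := congrArg LinearMap.det h
  rw [LinearMap.det_comp, LinearMap.det_id] at h2
  exact left_ne_zero_of_mul_eq_one h2

variable [ValuativeRel k] [TopologicalSpace k] [IsNonarchimedeanLocalField k]

/-- From here on only the parity of ord det Ad(t) matters. -/
theorem GroupDatum.map_sqrt_modulus (D : GroupDatum k R m r) {σ : ℂ ≃+* ℂ} {ε : ℂˣ}
    (hε : ε ^ 2 = 1) (h : σ (Real.sqrt (Nat.card 𝓀[k]) : ℂ) = ε * (Real.sqrt (Nat.card 𝓀[k]) : ℂ))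
    (t : D.torus) : σ (Real.sqrt (D.modulus t) : ℂ) =
      (ε ^ ord k (LinearMap.det (D.Ad t)) : ℂˣ) * (Real.sqrt (D.modulus t) : ℂ) := by
  rw [GroupDatum.modulus, normAbs_of_ne_zero (D.det_Ad_ne_zero t)]
  exact map_sqrt_zpow hε h _

end Modulus

/-! ### Parity of sums over positive roots -/

section Parity

/-- Handshake argument: modulo 2, aᵢ - aⱼ is aᵢ + aⱼ, and summing this over the edges of the graph Q
counts each aᵢ with the degree of i. -/
theorem even_sum_sub_sum {N : ℕ} (Q : Fin N → Fin N → Prop) [∀ i j, Decidable (Q i j)]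
    (hQ : ∀ i j, Q i j → Q j i) (a : Fin N → ℤ) :
    Even ((∑ p : {p : Fin N × Fin N // p.1 < p.2 ∧ Q p.1 p.2}, (a p.val.1 - a p.val.2)) -
      ∑ i, a i * (Finset.univ.filter fun j => j ≠ i ∧ Q i j).card) := by
  have hQ' : ∀ i j, Q i j ↔ Q j i := fun i j => ⟨hQ i j, hQ j i⟩
  rw [Finset.sum_subtype (p := fun p : Fin N × Fin N => p.1 < p.2 ∧ Q p.1 p.2)
    (Finset.univ.filter fun p : Fin N × Fin N => p.1 < p.2 ∧ Q p.1 p.2) (by simp)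
    (fun p : Fin N × Fin N => a p.1 - a p.2) |>.symm, Finset.sum_filter, Fintype.sum_prod_type]
  -- The neighbours of i are split into those above and those below. After exchanging the summations
  -- in the second part, an edge i < j carries aᵢ + aⱼ, which differs from aᵢ - aⱼ by 2aⱼ.
  have h1 : ∀ i, a i * ((Finset.univ.filter fun j => j ≠ i ∧ Q i j).card : ℤ) =
      (∑ j, if i < j ∧ Q i j then a i else 0) + ∑ j, if j < i ∧ Q j i then a i else 0 := by
    intro i
    rw [Finset.card_filter, Nat.cast_sum, Finset.mul_sum, ← Finset.sum_add_distrib]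
    refine Finset.sum_congr rfl fun j _ => ?_
    simp only [hQ' j i]
    rcases lt_trichotomy i j with h | h | h
    · simp [h, h.not_gt, h.ne']
    · simp [h]
    · simp [h, h.not_gt, h.ne]
  rw [Finset.sum_congr rfl fun i _ => h1 i, Finset.sum_add_distrib,
    Finset.sum_comm (f := fun i j => if j < i ∧ Q j i then a i else 0), ← Finset.sum_add_distrib,
    ← Finset.sum_sub_distrib]
  refine Finset.even_sum _ fun i _ => ?_
  rw [← Finset.sum_add_distrib, ← Finset.sum_sub_distrib]
  refine Finset.even_sum _ fun j _ => ?_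
  split_ifs
  · exact ⟨-a j, by ring⟩
  · simp

/-- The complete graph, where every degree is N - 1. -/
theorem even_sum_pairs {N : ℕ} (a : Fin N → ℤ) :
    Even ((∑ p : {p : Fin N × Fin N // p.1 < p.2}, (a p.val.1 - a p.val.2)) -
      ((N : ℤ) - 1) * ∑ i, a i) := by
  have h := even_sum_sub_sum (fun _ _ => True) (fun _ _ h => h) a
  have e : ∀ i : Fin N, ((Finset.univ.filter fun j => j ≠ i ∧ True).card : ℤ) = (N : ℤ) - 1 := by
    intro i
    have h1 : (Finset.univ.filter fun j => j ≠ i ∧ True) = Finset.univ.erase i := by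
      ext j
      simp
    rw [h1, Finset.card_erase_of_mem (Finset.mem_univ i), Finset.card_univ, Fintype.card_fin,
      Nat.cast_sub (by have := i.pos; omega), Nat.cast_one]
  simp only [e, ← Finset.sum_mul] at h
  rw [mul_comm]
  convert h using 2
  exact Fintype.sum_equiv (Equiv.subtypeEquivRight (by simp)) _ _ fun _ => rfl

/-- The condition p.1.rev < p.2 selects one pair from each orbit of (i, j) ↦ (j.rev, i.rev) off the
anti-diagonal: one for each free entry of the Lie algebra. If c(i) is the degree of i in this graph,
the terms of i and i.rev combine to aᵢ(c(i) - c(i.rev)), and c(i) + c(i.rev) + 2 is the number of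
elements of P. -/
theorem even_sum_folded_pairs {N : ℕ} (P : Fin N → Prop) [DecidablePred P]
    (hP : ∀ i, P i → P i.rev) (a : Fin N → ℤ) (ha : ∀ i, P i → a i.rev = -a i) :
    Even ((∑ p : {p : Fin N × Fin N // p.1 < p.2 ∧ P p.1 ∧ P p.2 ∧ p.1.rev < p.2},
      (a p.val.1 - a p.val.2)) -
      (Finset.univ.filter P).card * ∑ i ∈ Finset.univ.filter (fun i => P i ∧ i < i.rev), a i) := by
  have hP' : ∀ i, P i.rev ↔ P i := fun i => ⟨fun h => by simpa using hP _ h, hP i⟩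
  have h := even_sum_sub_sum (fun i j => P i ∧ P j ∧ i.rev < j)
    (fun i j ⟨h1, h2, h3⟩ => ⟨h2, h1, by rwa [Fin.rev_lt_iff]⟩) a
  set c : Fin N → ℕ := fun i => (Finset.univ.filter fun j => j ≠ i ∧ P i ∧ P j ∧ i.rev < j).card
    with hc
  rw [← sub_add_sub_cancel _ (∑ i, a i * (c i : ℤ)) _]
  refine h.add ?_
  have hsum : ∑ i, a i * (c i : ℤ) =
      ∑ i ∈ Finset.univ.filter (fun i => P i ∧ i < i.rev), a i * ((c i : ℤ) - c i.rev) := by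
    have h0 : ∀ i, a i * (c i : ℤ) = (if P i ∧ i < i.rev then a i * (c i : ℤ) else 0) +
        (if P i ∧ i.rev < i then a i * (c i : ℤ) else 0) := by
      intro i
      by_cases hi : P i
      · rcases lt_trichotomy i i.rev with h | h | h
        · simp [hi, h, h.not_gt]
        · have := ha i hi
          -- A self-opposite index contributes nothing, since there aᵢ = -aᵢ.
          rw [← h] at this
          have h0 : a i = 0 := by omega
          simp [h0]
        · simp [hi, h, h.not_gt]
      · simp [hi, hc]
    rw [Finset.sum_congr rfl fun i _ => h0 i, Finset.sum_add_distrib, Finset.sum_filter]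
    rw [← Equiv.sum_comp Fin.revPerm (fun i => if P i ∧ i.rev < i then a i * (c i : ℤ) else 0),
      ← Finset.sum_add_distrib]
    refine Finset.sum_congr rfl fun i _ => ?_
    simp only [Fin.revPerm_apply, Fin.rev_rev, hP']
    split_ifs with h1
    · rw [ha i h1.1]
      ring
    · simp
  rw [hsum, Finset.mul_sum, ← Finset.sum_sub_distrib]
  refine Finset.even_sum _ fun i hi => ?_
  obtain ⟨hi1, hi2⟩ := (Finset.mem_filter.mp hi).2
  -- Reversal turns the neighbours of i into the elements of P below i, while those of i.rev are the
  -- elements of P above i other than i.rev. Together they miss exactly i and i.rev.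
  have hcount : c i + c i.rev + 2 = (Finset.univ.filter P).card := by
    have h1 : c i = (Finset.univ.filter fun j => j ≠ i.rev ∧ P j ∧ j < i).card := by
      refine Finset.card_equiv Fin.revPerm fun j => ?_
      simp only [Finset.mem_filter, Finset.mem_univ, true_and, Fin.revPerm_apply, hP', hi1]
      rw [Fin.rev_lt_iff, ne_eq, ne_eq, Fin.rev_inj]
    have h2 : c i.rev = (Finset.univ.filter fun j => j ≠ i.rev ∧ P j ∧ i < j).card := by
      simp only [hc, hP', hi1, Fin.rev_rev, true_and]
    rw [h1, h2, ← Finset.card_union_of_disjoint]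
    · have h3 : ((Finset.univ.filter P).erase i.rev).erase i =
          (Finset.univ.filter fun j => j ≠ i.rev ∧ P j ∧ j < i) ∪
            (Finset.univ.filter fun j => j ≠ i.rev ∧ P j ∧ i < j) := by
        ext j
        simp only [Finset.mem_erase, Finset.mem_filter, Finset.mem_univ, true_and,
          Finset.mem_union, ne_eq, ← lt_or_lt_iff_ne]
        tauto
      rw [← h3, Finset.card_erase_of_mem, Finset.card_erase_of_mem]
      · have : 2 ≤ (Finset.univ.filter P).card := by
          rw [← Finset.card_pair hi2.ne]
          refine Finset.card_le_card ?_
          intro j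
          simp only [Finset.mem_insert, Finset.mem_singleton, Finset.mem_filter, Finset.mem_univ,
            true_and]
          rintro (rfl | rfl)
          · exact hi1
          · exact hP _ hi1
        omega
      · simp [hP', hi1]
      · simp [hi1, hi2.ne]
    · rw [Finset.disjoint_filter]
      rintro j - ⟨-, -, h⟩ ⟨-, -, h'⟩
      exact absurd h h'.not_gt
  rw [← hcount]
  exact ⟨-(a i * (c i.rev : ℤ)) - a i, by push_cast; ring⟩

end Parity

/-! ### The determinant of the adjoint action -/

section Determinant

theorem det_eq_of_equivariant {k M M' : Type*} [Field k] [AddCommGroup M] [Module k M]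
    [AddCommGroup M'] [Module k M'] (e : M ≃ₗ[k] M') (f : M →ₗ[k] M) (f' : M' →ₗ[k] M')
    (h : ∀ x, e (f x) = f' (e x)) : LinearMap.det f = LinearMap.det f' := by
  rw [← LinearMap.det_conj f e]
  congr 1
  ext x
  simp [h]

variable {k R : Type*} [Field k] [Field R] [Algebra k R] {m r : ℕ}

/-- An entry of the adjoint action in a column that forms a block of its own. -/
theorem GroupDatum.Ad_apply_col (D : GroupDatum k R m r) (t : D.torus) (X : D.nilradical)
    (i : Fin m) {j : Fin m} (hj : ∀ l, D.block l = D.block j → l = j) :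
    (D.Ad t X).val i j = (∑ l, t.val.val.val i l * X.val l j) * (t.val.val.val j j)⁻¹ := by
  show (t.val.val.val * X.val * (t⁻¹).val.val.val) i j = _
  rw [Matrix.mul_apply, Finset.sum_eq_single j, Matrix.mul_apply]
  · rw [eq_inv_of_mul_eq_one_right (D.torus_diag_mul_inv hj t)]
  · intro l _ hl
    rw [show (t⁻¹).val.val.val l j = 0 from (t.property l j fun h => hl (hj l h)).2, mul_zero]
  · simp

theorem GroupDatum.Ad_apply_entry (D : GroupDatum k R m r) (t : D.torus) (X : D.nilradical)
    {i j : Fin m} (hi : ∀ l, D.block l = D.block i → l = i)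
    (hj : ∀ l, D.block l = D.block j → l = j) :
    (D.Ad t X).val i j = t.val.val.val i i / t.val.val.val j j * X.val i j := by
  rw [D.Ad_apply_col t X i hj, Finset.sum_eq_single i]
  · ring
  · intro l _ hl
    rw [(t.property i l fun h => hl (hi l h.symm)).1, zero_mul]
  · simp

theorem gl_block (F : Type*) [Field F] (N : ℕ) (i j : Fin N)
    (h : (gl F N).block j = (gl F N).block i) : j = i :=
  Fin.ext h

/-- The strictly upper triangular entries are coordinates on the nilradical of `GL(N)`. -/
def glNilradicalEquiv (F : Type*) [Field F] (N : ℕ) :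
    (gl F N).nilradical ≃ₗ[F] ({p : Fin N × Fin N // p.1 < p.2} → F) where
  toFun X p := X.val p.val.1 p.val.2
  invFun x := ⟨fun i j => if h : i < j then x ⟨(i, j), h⟩ else 0, Submodule.mem_top,
    fun i j h => dif_neg (not_lt.mpr h)⟩
  map_add' _ _ := rfl
  map_smul' _ _ := rfl
  left_inv X := by
    ext i j
    by_cases h : i < j
    · simp [h]
    · simp only [h, dif_neg, not_false_eq_true]
      exact (X.property.2 i j (not_lt.mp h)).symm
  right_inv x := by
    ext p
    simp [p.property]

/-- The strictly upper triangular entries are eigencoordinates, with eigenvalues tᵢ/tⱼ. -/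
theorem gl_det_Ad {F : Type*} [Field F] {N : ℕ} (t : (gl F N).torus) :
    LinearMap.det ((gl F N).Ad t) =
      ∏ p : {p : Fin N × Fin N // p.1 < p.2},
        (t.val.val.val p.val.1 p.val.1 / t.val.val.val p.val.2 p.val.2) := by
  rw [det_eq_of_equivariant (glNilradicalEquiv F N) _
    (LinearMap.pi fun p => (LinearMap.mulLeft F
      (t.val.val.val p.val.1 p.val.1 / t.val.val.val p.val.2 p.val.2)).comp (LinearMap.proj p)),
    LinearMap.det_pi]
  · simp
  · intro X
    ext p
    exact (gl F N).Ad_apply_entry t X (gl_block F N _) (gl_block F N _)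

variable {F : Type*} [Field F] [ValuativeRel F] [TopologicalSpace F] [IsNonarchimedeanLocalField F]

theorem gl_even_ord_det_Ad {N : ℕ} (t : (gl F N).torus) :
    Even (ord F (LinearMap.det ((gl F N).Ad t)) -
      ((N : ℤ) - 1) * ∑ i, ord F (t.val.val.val i i)) := by
  have h0 : ∀ i, t.val.val.val i i ≠ 0 := fun i =>
    (gl F N).torus_diag_ne_zero (gl_block F N i) t
  rw [gl_det_Ad, ord_prod _ _ fun p _ => div_ne_zero (h0 _) (h0 _)]
  simp only [ord_div (h0 _) (h0 _)]
  exact even_sum_pairs fun i => ord F (t.val.val.val i i)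

end Determinant

/-! ### The nilradical of a quasi-split isometry group -/

section QuasiSplit

variable {k R : Type*} [Field k] [Field R] [Algebra k R] {m r : ℕ}

/-- The group is contained in the isometry group of the `ε`-hermitian form with Gram matrix `J`.
This matrix is anti-diagonal with entries `d` on the basis vectors in `P`, and the remaining basis
vectors are in the middle and form one block. -/
structure GroupDatum.IsQuasiSplit (D : GroupDatum k R m r) (c : R ≃ₐ[k] R)
    (J : Matrix (Fin m) (Fin m) R) (P : Fin m → Prop) (d : Fin m → R) (ε : R) : Prop where
  group_le : D.group ≤ isometryGroup c J
  lie_eq : D.lie = isometryLie c J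
  rev_mem : ∀ i, P i → P i.rev
  gram_row : ∀ i j, P i → J i j = if j = i.rev then d i else 0
  gram_mixed : ∀ i j, ¬P i → P j → J i j = 0
  conj_conj : ∀ x, c (c x) = x
  gram_conj : ∀ i j, c (J j i) = ε * J i j
  sq_eq_one : ε * ε = 1
  entry_ne_zero : ∀ i, P i → d i ≠ 0
  entry_conj : ∀ i, P i → c (d i) = d i
  block_lt : ∀ i j, P i ∨ P j → (D.block i < D.block j ↔ i < j)
  block_eq : ∀ i j, ¬P i → ¬P j → D.block i = D.block j
  lt_middle : ∀ i l, P i → ¬P l → (i < l ↔ i < i.rev)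
  middle_lt : ∀ i l, P i → ¬P l → (l < i ↔ i.rev < i)

namespace GroupDatum.IsQuasiSplit

variable {D : GroupDatum k R m r} {c : R ≃ₐ[k] R} {J : Matrix (Fin m) (Fin m) R}
  {P : Fin m → Prop} {d : Fin m → R} {ε : R}

theorem singleton (h : D.IsQuasiSplit c J P d ε) {i : Fin m} (hi : P i) (j : Fin m)
    (hj : D.block j = D.block i) : j = i := by
  have h1 := h.block_lt i j (Or.inl hi)
  have h2 := h.block_lt j i (Or.inr hi)
  rw [hj] at h1 h2
  exact le_antisymm (not_lt.mp fun h' => lt_irrefl _ (h1.mpr h'))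
    (not_lt.mp fun h' => lt_irrefl _ (h2.mpr h'))

theorem gram_col (h : D.IsQuasiSplit c J P d ε) {i j : Fin m} (hj : P j) :
    J i j = if i = j.rev then d j.rev else 0 := by
  by_cases hi : P i
  · rw [h.gram_row i j hi]
    by_cases hij : i = j.rev
    · simp [hij]
    · have : j ≠ i.rev := fun e => hij (by simp [e])
      simp [hij, this]
  · rw [h.gram_mixed i j hi hj, if_neg]
    rintro rfl
    exact hi (h.rev_mem j hj)

theorem gram_mixed' (h : D.IsQuasiSplit c J P d ε) {i j : Fin m} (hi : P i) (hj : ¬P j) :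
    J i j = 0 := by
  rw [h.gram_row i j hi, if_neg]
  rintro rfl
  exact hj (h.rev_mem i hi)

theorem entry_rev (h : D.IsQuasiSplit c J P d ε) {i : Fin m} (hi : P i) :
    d i.rev = ε * d i := by
  have h1 := h.gram_conj i i.rev
  rw [h.gram_row _ _ (h.rev_mem i hi), h.gram_row _ _ hi] at h1
  simpa [h.entry_conj _ (h.rev_mem i hi)] using h1

/-- The entries of the matrix `X* J + J X`, which vanish on the Lie algebra. -/
theorem mem_lie_iff (h : D.IsQuasiSplit c J P d ε) (X : Matrix (Fin m) (Fin m) R) :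
    X ∈ D.lie ↔ ∀ a b, (∑ l, c (X l a) * J l b) + ∑ l, J a l * X l b = 0 := by
  rw [h.lie_eq]
  show (X.map c).transpose * J + J * X = 0 ↔ _
  rw [← Matrix.ext_iff]
  rfl

/-- X*J + JX inherits from J the ε-hermitian symmetry, so that only half of the equations need
checking. -/
theorem lie_entry_symm (h : D.IsQuasiSplit c J P d ε) (X : Matrix (Fin m) (Fin m) R)
    (a b : Fin m) (h0 : (∑ l, c (X l a) * J l b) + ∑ l, J a l * X l b = 0) :
    (∑ l, c (X l b) * J l a) + ∑ l, J b l * X l a = 0 := by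
  have h1 := congrArg c h0
  rw [map_add, map_sum, map_sum, map_zero] at h1
  simp only [map_mul, h.conj_conj, h.gram_conj] at h1
  have h2 : ε * ((∑ l, c (X l b) * J l a) + ∑ l, J b l * X l a) = 0 := by
    rw [← h1, mul_add, Finset.mul_sum, Finset.mul_sum, add_comm]
    congr 1 <;> exact Finset.sum_congr rfl fun l _ => by ring
  exact (mul_eq_zero.mp h2).resolve_left (left_ne_zero_of_mul_eq_one h.sq_eq_one)

theorem sum_row (h : D.IsQuasiSplit c J P d ε) (X : Matrix (Fin m) (Fin m) R) {a : Fin m}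
    (ha : P a) (b : Fin m) : ∑ l, J a l * X l b = d a * X a.rev b := by
  simp [h.gram_row a _ ha]

theorem sum_col (h : D.IsQuasiSplit c J P d ε) (X : Matrix (Fin m) (Fin m) R) (a : Fin m)
    {b : Fin m} (hb : P b) : ∑ l, c (X l a) * J l b = c (X b.rev a) * d b.rev := by
  simp [h.gram_col hb]

/-- The Lie algebra relation at (i.rev, j): it ties the entry at (i, j) to its reflection in the
anti-diagonal, so one of the two is free. -/
theorem entry_eq (h : D.IsQuasiSplit c J P d ε) {X : Matrix (Fin m) (Fin m) R} (hX : X ∈ D.lie)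
    {i j : Fin m} (hi : P i) (hj : P j) :
    c (X j.rev i.rev) * d j.rev + d i.rev * X i j = 0 := by
  have h1 := (h.mem_lie_iff X).mp hX i.rev j
  rwa [h.sum_row X (h.rev_mem i hi), h.sum_col X _ hj, Fin.rev_rev] at h1

theorem entry_eq_middle (h : D.IsQuasiSplit c J P d ε) {X : Matrix (Fin m) (Fin m) R}
    (hX : X ∈ D.lie) {i : Fin m} (hi : P i) (j : Fin m) :
    (∑ l, c (X l i.rev) * J l j) + d i.rev * X i j = 0 := by
  have h1 := (h.mem_lie_iff X).mp hX i.rev j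
  rwa [h.sum_row X (h.rev_mem i hi), Fin.rev_rev] at h1

/-- Elements of the nilradical are determined by the entries below the anti-diagonal, those on it,
and those in the rows of the middle block. -/
theorem eq_zero_of_entries (h : D.IsQuasiSplit c J P d ε) {X : Matrix (Fin m) (Fin m) R}
    (hX : X ∈ D.nilradical)
    (h1 : ∀ i j, P i → P j → i < j → i.rev < j → X i j = 0)
    (h2 : ∀ i, P i → i < i.rev → X i i.rev = 0)
    (h3 : ∀ l j, ¬P l → P j → j.rev < j → X l j = 0) : X = 0 := by
  ext i j
  rw [Matrix.zero_apply]
  by_cases hb : D.block j ≤ D.block i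
  · exact hX.2 i j hb
  rw [not_le] at hb
  by_cases hi : P i <;> by_cases hj : P j
  · have hij := (h.block_lt i j (Or.inl hi)).mp hb
    rcases lt_trichotomy i.rev j with hr | hr | hr
    · exact h1 i j hi hj hij hr
    · subst hr
      exact h2 i hi hij
    -- The reflected position (j.rev, i.rev) falls in the range of `h1`.
    · have e := h.entry_eq hX.1 hi hj
      rw [h1 j.rev i.rev (h.rev_mem j hj) (h.rev_mem i hi) (Fin.rev_lt_rev.mpr hij)
        (by rwa [Fin.rev_rev]), map_zero, zero_mul, zero_add] at e
      exact (mul_eq_zero.mp e).resolve_left (h.entry_ne_zero _ (h.rev_mem i hi))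
  · have hij := (h.lt_middle i j hi hj).mp ((h.block_lt i j (Or.inl hi)).mp hb)
    have e := h.entry_eq_middle hX.1 hi j
    rw [Finset.sum_eq_zero, zero_add] at e
    · exact (mul_eq_zero.mp e).resolve_left (h.entry_ne_zero _ (h.rev_mem i hi))
    · intro l _
      by_cases hl : P l
      · rw [h.gram_mixed' hl hj, mul_zero]
      · rw [h3 l i.rev hl (h.rev_mem i hi) (by rwa [Fin.rev_rev]), map_zero, zero_mul]
  · exact h3 i j hi hj ((h.middle_lt j i hj hi).mp ((h.block_lt i j (Or.inr hj)).mp hb))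
  · exact absurd (h.block_eq i j hi hj) hb.ne

-- The free entries x, z, y can be prescribed at will: all others are then forced by `entry_eq` and
-- `entry_eq_middle`, and the matrix below is defined by solving these relations. The condition on z
-- is the relation that an anti-diagonal entry satisfies with itself.
open Classical in
theorem exists_mem_nilradical (h : D.IsQuasiSplit c J P d ε) (x y : Fin m → Fin m → R)
    (z : Fin m → R) (hz : ∀ i, c (z i) + ε * z i = 0) :
    ∃ X ∈ D.nilradical, (∀ i j, P i → P j → i < j → i.rev < j → X i j = x i j) ∧
      (∀ i, P i → i < i.rev → X i i.rev = z i) ∧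
      (∀ l j, ¬P l → P j → j.rev < j → X l j = y l j) := by
  let X : Matrix (Fin m) (Fin m) R := fun i j =>
    if P i then
      if P j then
        if i < j then
          if i.rev < j then x i j
          else if j = i.rev then z i
          else -((d i.rev)⁻¹ * (c (x j.rev i.rev) * d j.rev))
        else 0
      else if i < i.rev then -((d i.rev)⁻¹ * ∑ l, if P l then 0 else c (y l i.rev) * J l j)
      else 0
    else if P j ∧ j.rev < j then y i j else 0
  have X1 : ∀ i j, P i → P j → i < j → i.rev < j → X i j = x i j := by
    intro i j hi hj h1 h2
    simp [X, hi, hj, h1, h2]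
  have X2 : ∀ i, P i → i < i.rev → X i i.rev = z i := by
    intro i hi h1
    simp [X, hi, h.rev_mem i hi, h1]
  have X3 : ∀ l j, ¬P l → P j → j.rev < j → X l j = y l j := by
    intro l j hl hj h1
    simp [X, hl, hj, h1]
  have X4 : ∀ i j, P i → P j → i < j → j < i.rev →
      X i j = -((d i.rev)⁻¹ * (c (x j.rev i.rev) * d j.rev)) := by
    intro i j hi hj h1 h2
    simp [X, hi, hj, h1, h2.not_gt, h2.ne]
  have X5 : ∀ i j, P i → ¬P j → i < i.rev →
      X i j = -((d i.rev)⁻¹ * ∑ l, if P l then 0 else c (y l i.rev) * J l j) := by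
    intro i j hi hj h1
    simp [X, hi, hj, h1]
  have X6 : ∀ i j, P i → P j → ¬i < j → X i j = 0 := by
    intro i j hi hj h1
    simp [X, hi, hj, h1]
  have X7 : ∀ i j, P i → ¬P j → ¬i < i.rev → X i j = 0 := by
    intro i j hi hj h1
    simp [X, hi, hj, h1]
  have X8 : ∀ l j, ¬P l → ¬(P j ∧ j.rev < j) → X l j = 0 := by
    intro l j hl h1
    simp only [X, hl, h1, if_false]
  refine ⟨X, ⟨(h.mem_lie_iff X).mpr ?_, ?_⟩, X1, X2, X3⟩
  -- Positions with b ≤ i.rev suffice, by `lie_entry_symm`. The equality b = i.rev involves only the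
  -- anti-diagonal entry of X, and there the equation is `hz`.
  · have hPP : ∀ i b, P i → P b → b ≤ i.rev →
        (∑ l, c (X l i.rev) * J l b) + ∑ l, J i.rev l * X l b = 0 := by
      intro i b hi hb hle
      rw [h.sum_row X (h.rev_mem i hi), h.sum_col X _ hb, Fin.rev_rev]
      by_cases hib : i < b
      · rcases hle.lt_or_eq with hlt | rfl
        · rw [X4 i b hi hb hib hlt, X1 b.rev i.rev (h.rev_mem b hb) (h.rev_mem i hi)
            (Fin.rev_lt_rev.mpr hib) (by rwa [Fin.rev_rev]), mul_neg,
            mul_inv_cancel_left₀ (h.entry_ne_zero _ (h.rev_mem i hi)), add_neg_cancel]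
        · rw [Fin.rev_rev, X2 i hi hib, h.entry_rev hi]
          linear_combination d i * hz i
      · rw [X6 i b hi hb hib, X6 b.rev i.rev (h.rev_mem b hb) (h.rev_mem i hi)
          (by rwa [Fin.rev_lt_rev])]
        simp
    have hPM : ∀ i b, P i → ¬P b →
        (∑ l, c (X l i.rev) * J l b) + ∑ l, J i.rev l * X l b = 0 := by
      intro i b hi hb
      rw [h.sum_row X (h.rev_mem i hi), Fin.rev_rev]
      by_cases hlt : i < i.rev
      · rw [X5 i b hi hb hlt, mul_neg, mul_inv_cancel_left₀ (h.entry_ne_zero _ (h.rev_mem i hi)),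
          ← sub_eq_add_neg, sub_eq_zero]
        refine Finset.sum_congr rfl fun l _ => ?_
        by_cases hl : P l
        · rw [h.gram_mixed' hl hb, mul_zero, if_pos hl]
        · rw [X3 l i.rev hl (h.rev_mem i hi) (by rwa [Fin.rev_rev]), if_neg hl]
      · rw [X7 i b hi hb hlt, mul_zero, add_zero]
        refine Finset.sum_eq_zero fun l _ => ?_
        by_cases hl : P l
        · rw [h.gram_mixed' hl hb, mul_zero]
        · rw [X8 l i.rev hl (fun hh => hlt (by simpa using hh.2)), map_zero, zero_mul]
    intro a b
    by_cases ha : P a <;> by_cases hb : P b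
    · rcases le_total b a with hab | hab
      · simpa using hPP a.rev b (h.rev_mem a ha) hb (by simpa using hab)
      · refine h.lie_entry_symm X b a ?_
        simpa using hPP b.rev a (h.rev_mem b hb) ha (by simpa using hab)
    · simpa using hPM a.rev b (h.rev_mem a ha) hb
    · refine h.lie_entry_symm X b a ?_
      simpa using hPM b.rev a (h.rev_mem b hb) ha
    -- Both indices are in the middle: J does not mix the middle with P, and X has no entries inside
    -- the middle block.
    · rw [Finset.sum_eq_zero, Finset.sum_eq_zero, add_zero]
      · intro l _
        by_cases hl : P l
        · rw [h.gram_mixed a l ha hl, zero_mul]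
        · rw [X8 l b hl fun hh => hb hh.1, mul_zero]
      · intro l _
        by_cases hl : P l
        · rw [h.gram_mixed' hl hb, mul_zero]
        · rw [X8 l a hl fun hh => ha hh.1, map_zero, zero_mul]
  · intro i j hb
    have hb' : ¬D.block i < D.block j := not_lt.mpr hb
    by_cases hi : P i <;> by_cases hj : P j
    · exact X6 i j hi hj (by rwa [← h.block_lt i j (Or.inl hi)])
    · exact X7 i j hi hj (by rwa [← h.lt_middle i j hi hj, ← h.block_lt i j (Or.inl hi)])
    · refine X8 i j hi ?_
      rintro ⟨-, hlt⟩
      exact hb' (by rwa [h.block_lt i j (Or.inr hj), h.middle_lt j i hj hi])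
    · exact X8 i j hi fun hh => hj hh.1

end GroupDatum.IsQuasiSplit

end QuasiSplit

/-! ### Coordinates on the nilradical and the determinant of Ad -/

section QuasiSplit

variable {k R : Type*} [Field k] [Field R] [Algebra k R] {m r : ℕ}

/-- The anti-diagonal entries of the Lie algebra, in suitable coordinates. -/
def antiHermitian (c : R ≃ₐ[k] R) (ε : R) : Submodule k R :=
  LinearMap.ker (c.toLinearMap + LinearMap.mulLeft k ε)

theorem mem_antiHermitian {c : R ≃ₐ[k] R} {ε x : R} :
    x ∈ antiHermitian c ε ↔ c x + ε * x = 0 := Iff.rfl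

namespace GroupDatum.IsQuasiSplit

variable {D : GroupDatum k R m r} {c : R ≃ₐ[k] R} {J : Matrix (Fin m) (Fin m) R}
  {P : Fin m → Prop} {d : Fin m → R} {ε : R}

theorem antidiagonal_mem (h : D.IsQuasiSplit c J P d ε) {X : Matrix (Fin m) (Fin m) R}
    (hX : X ∈ D.lie) {i : Fin m} (hi : P i) : X i i.rev ∈ antiHermitian c ε := by
  have e := h.entry_eq hX hi (h.rev_mem i hi)
  rw [Fin.rev_rev, h.entry_rev hi] at e
  have h0 := h.entry_ne_zero i hi
  rw [mem_antiHermitian]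
  apply mul_left_cancel₀ h0
  linear_combination e

variable (P) in
/-- The space of coordinates on the nilradical of a quasi-split isometry group. -/
abbrev Coordinates (c : R ≃ₐ[k] R) (ε : R) : Type _ :=
  ({p : Fin m × Fin m // p.1 < p.2 ∧ P p.1 ∧ P p.2 ∧ p.1.rev < p.2} → R) ×
    ({i : Fin m // P i ∧ i < i.rev} → antiHermitian c ε) ×
      ({j : Fin m // P j ∧ j.rev < j} → {l : Fin m // ¬P l} → R)

/-- The coordinates of an element of the nilradical. -/
def coordinates (h : D.IsQuasiSplit c J P d ε) : D.nilradical →ₗ[k] Coordinates P c ε where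
  toFun X := ⟨fun p => X.val p.val.1 p.val.2,
    fun i => ⟨X.val i.val i.val.rev, h.antidiagonal_mem X.property.1 i.property.1⟩,
    fun j l => X.val l.val j.val⟩
  map_add' _ _ := rfl
  map_smul' _ _ := rfl

theorem coordinates_injective (h : D.IsQuasiSplit c J P d ε) :
    Function.Injective h.coordinates := by
  rw [injective_iff_map_eq_zero]
  intro X hX
  have e1 := congrArg Prod.fst hX
  have e2 := congrArg (fun z => z.2.1) hX
  have e3 := congrArg (fun z => z.2.2) hX
  refine Subtype.ext (h.eq_zero_of_entries X.property (fun i j hi hj h1 h2 => ?_)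
    (fun i hi h1 => ?_) (fun l j hl hj h1 => ?_))
  · exact congrFun e1 ⟨(i, j), h1, hi, hj, h2⟩
  · exact congrArg Subtype.val (congrFun e2 ⟨i, hi, h1⟩)
  · exact congrFun (congrFun e3 ⟨j, hj, h1⟩) ⟨l, hl⟩

open Classical in
theorem coordinates_surjective (h : D.IsQuasiSplit c J P d ε) :
    Function.Surjective h.coordinates := by
  rintro ⟨x, z, y⟩
  obtain ⟨X, hX, h1, h2, h3⟩ := h.exists_mem_nilradical
    (fun i j => if hp : i < j ∧ P i ∧ P j ∧ i.rev < j then x ⟨(i, j), hp⟩ else 0)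
    (fun l j => if hp : (P j ∧ j.rev < j) ∧ ¬P l then y ⟨j, hp.1⟩ ⟨l, hp.2⟩ else 0)
    (fun i => if hp : P i ∧ i < i.rev then (z ⟨i, hp⟩ : R) else 0)
    (fun i => by
      split_ifs with hp
      · exact (z ⟨i, hp⟩).property
      · simp)
  refine ⟨⟨X, hX⟩, Prod.ext ?_ (Prod.ext ?_ ?_)⟩
  · ext ⟨p, hp⟩
    show X p.1 p.2 = _
    rw [h1 p.1 p.2 hp.2.1 hp.2.2.1 hp.1 hp.2.2.2, dif_pos hp]
  · ext ⟨i, hi⟩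
    show X i i.rev = _
    rw [h2 i hi.1 hi.2, dif_pos hi]
  · ext ⟨j, hj⟩ ⟨l, hl⟩
    show X l j = _
    rw [h3 l j hl hj.1 hj.2, dif_pos ⟨hj, hl⟩]

/-- This is the entry (i, i.rev) of t*Jt = J, where one term survives in each sum because i and
i.rev are singleton blocks. -/
theorem conj_diag_mul (h : D.IsQuasiSplit c J P d ε) (t : D.torus) {i : Fin m} (hi : P i) :
    c (t.val.val.val i i) * t.val.val.val i.rev i.rev = 1 := by
  have ht : (t.val.val.val.map c).transpose * J * t.val.val.val = J := h.group_le t.val.property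
  have e := congrFun (congrFun ht i) i.rev
  rw [Matrix.mul_apply, Finset.sum_eq_single i.rev, Matrix.mul_apply, Finset.sum_eq_single i] at e
  · simp only [Matrix.transpose_apply, Matrix.map_apply, h.gram_row i _ hi, if_true] at e
    apply mul_left_cancel₀ (h.entry_ne_zero i hi)
    linear_combination e
  · intro l _ hl
    rw [Matrix.transpose_apply, Matrix.map_apply,
      (t.property l i fun hh => hl (h.singleton hi l hh)).1, map_zero, zero_mul]
  · simp
  · intro l _ hl
    rw [(t.property l i.rev fun hh => hl (h.singleton (h.rev_mem i hi) l hh)).1, mul_zero]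
  · simp

theorem diag_ne_zero (h : D.IsQuasiSplit c J P d ε) (t : D.torus) {i : Fin m} (hi : P i) :
    t.val.val.val i i ≠ 0 :=
  D.torus_diag_ne_zero (h.singleton hi) t

/-- The middle block of an element of the torus. -/
def middle (P : Fin m → Prop) (t : D.torus) : Matrix {l : Fin m // ¬P l} {l : Fin m // ¬P l} R :=
  t.val.val.val.submatrix Subtype.val Subtype.val

/-- In these coordinates Ad(t) is a direct sum. A free entry is scaled by tᵢ/tⱼ in R, which
contributes a norm to k. An anti-diagonal entry is scaled by tᵢ c(tᵢ), which comes from `s i` in k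
and so acts on the k-space `antiHermitian c ε` as a scalar. A middle column is acted on by the
middle block of t, divided by tⱼ. -/
theorem det_Ad [Module.Finite k R] [DecidablePred P] (h : D.IsQuasiSplit c J P d ε)
    (t : D.torus) (s : Fin m → k)
    (hs : ∀ i, P i → algebraMap k R (s i) = t.val.val.val i i * c (t.val.val.val i i)) :
    LinearMap.det (D.Ad t) =
      (∏ p : {p : Fin m × Fin m // p.1 < p.2 ∧ P p.1 ∧ P p.2 ∧ p.1.rev < p.2},
        Algebra.norm k (t.val.val.val p.val.1 p.val.1 / t.val.val.val p.val.2 p.val.2)) *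
      ((∏ i : {i : Fin m // P i ∧ i < i.rev}, s i ^ Module.finrank k (antiHermitian c ε)) *
      ∏ j : {j : Fin m // P j ∧ j.rev < j}, Algebra.norm k
        ((t.val.val.val j j)⁻¹ ^ Fintype.card {l : Fin m // ¬P l} * (middle P t).det)) := by
  rw [det_eq_of_equivariant
    (LinearEquiv.ofBijective h.coordinates ⟨h.coordinates_injective, h.coordinates_surjective⟩) _
    (LinearMap.prodMap
      (LinearMap.pi fun p => (LinearMap.mulLeft k
        (t.val.val.val p.val.1 p.val.1 / t.val.val.val p.val.2 p.val.2)).comp (LinearMap.proj p))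
      (LinearMap.prodMap
        (LinearMap.pi fun i => (s i.val • (LinearMap.id : antiHermitian c ε →ₗ[k] _)).comp
          (LinearMap.proj i))
        (LinearMap.pi fun j => (((t.val.val.val j.val j.val)⁻¹ •
          Matrix.toLin' (middle P t)).restrictScalars k).comp (LinearMap.proj j)))),
    LinearMap.det_prodMap, LinearMap.det_prodMap, LinearMap.det_pi, LinearMap.det_pi,
    LinearMap.det_pi]
  · congr 1
    congr 1
    · refine Finset.prod_congr rfl fun i _ => ?_
      rw [LinearMap.det_smul, LinearMap.det_id, mul_one]
    · refine Finset.prod_congr rfl fun j _ => ?_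
      rw [LinearMap.det_restrictScalars, LinearMap.det_smul, LinearMap.det_toLin',
        Module.finrank_fintype_fun_eq_card]
  · intro X
    refine Prod.ext ?_ (Prod.ext ?_ ?_)
    · ext ⟨p, hp⟩
      exact D.Ad_apply_entry t X (h.singleton hp.2.1) (h.singleton hp.2.2.1)
    · ext ⟨i, hi⟩
      show (D.Ad t X).val i i.rev = s i • X.val i i.rev
      rw [D.Ad_apply_entry t X (h.singleton hi.1) (h.singleton (h.rev_mem i hi.1)),
        Algebra.smul_def, hs i hi.1, eq_inv_of_mul_eq_one_left (h.conj_diag_mul t hi.1),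
        div_eq_mul_inv]
    · ext ⟨j, hj⟩ ⟨l, hl⟩
      show (D.Ad t X).val l j = (t.val.val.val j j)⁻¹ *
        ∑ l' : {l : Fin m // ¬P l}, t.val.val.val l l' * X.val l' j
      rw [D.Ad_apply_col t X l (h.singleton hj.1), mul_comm]
      congr 1
      rw [← Finset.sum_subtype (p := fun l => ¬P l) (Finset.univ.filter fun l => ¬P l) (by simp)
        (fun l' => t.val.val.val l l' * X.val l' j), Finset.sum_filter]
      refine Finset.sum_congr rfl fun l' _ => ?_
      split_ifs with hl'
      · rw [(t.property l l' fun hh => hl (h.singleton hl' l hh ▸ hl')).1, zero_mul]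
      · rfl

end GroupDatum.IsQuasiSplit

end QuasiSplit

/-! ### Parity for a bilinear form -/

section Orthogonal

variable {k : Type*} [Field k] [ValuativeRel k] [TopologicalSpace k] [IsNonarchimedeanLocalField k]
  {m r : ℕ} {D : GroupDatum k k m r} {J : Matrix (Fin m) (Fin m) k}
  {P : Fin m → Prop} {d : Fin m → k} {ε : k}

/-- Anti-diagonal entries are scaled by tᵢ², so their contribution is even whatever the dimension of
`antiHermitian`. The middle columns contribute powers of tⱼ⁻¹ with even exponent. The remaining
pairs are counted by `even_sum_folded_pairs`. -/
theorem GroupDatum.IsQuasiSplit.even_ord_det_Ad [DecidablePred P]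
    (h : D.IsQuasiSplit AlgEquiv.refl J P d ε) (hP : Even (Fintype.card {l : Fin m // ¬P l}))
    (t : D.torus) (ht : (GroupDatum.IsQuasiSplit.middle P t).det = 1) :
    Even (ord k (LinearMap.det (D.Ad t)) - (Finset.univ.filter P).card *
      ∑ i ∈ Finset.univ.filter (fun i => P i ∧ i < i.rev), ord k (t.val.val.val i i)) := by
  have h0 : ∀ i, P i → t.val.val.val i i ≠ 0 := fun i hi => h.diag_ne_zero t hi
  have ha : ∀ i, P i → ord k (t.val.val.val i.rev i.rev) = -ord k (t.val.val.val i i) := by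
    intro i hi
    rw [eq_inv_of_mul_eq_one_right (h.conj_diag_mul t hi), AlgEquiv.coe_refl, id_eq,
      ord_inv (h0 i hi)]
  rw [h.det_Ad t (fun i => t.val.val.val i i ^ 2) fun i _ => sq _]
  simp only [Algebra.norm_self, MonoidHom.id_apply, ht, mul_one]
  rw [ord_mul, ord_mul, ord_prod, ord_prod, ord_prod]
  · have h1 : ∀ p : {p : Fin m × Fin m // p.1 < p.2 ∧ P p.1 ∧ P p.2 ∧ p.1.rev < p.2},
        ord k (t.val.val.val p.val.1 p.val.1 / t.val.val.val p.val.2 p.val.2) =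
          ord k (t.val.val.val p.val.1 p.val.1) - ord k (t.val.val.val p.val.2 p.val.2) :=
      fun p => ord_div (h0 _ p.property.2.1) (h0 _ p.property.2.2.1)
    rw [Finset.sum_congr rfl fun p _ => h1 p, add_sub_right_comm]
    refine (even_sum_folded_pairs P h.rev_mem (fun i => ord k (t.val.val.val i i)) ha).add
      (Even.add (Finset.even_sum _ fun i _ => ?_) (Finset.even_sum _ fun j _ => ?_))
    · rw [ord_pow (pow_ne_zero 2 (h0 i i.property.1)), ord_pow (h0 i i.property.1)]
      exact (even_two_mul _).mul_left _
    · rw [ord_pow (inv_ne_zero (h0 j j.property.1))]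
      exact Even.mul_right (by exact_mod_cast hP) _
  · exact fun j _ => pow_ne_zero _ (inv_ne_zero (h0 j j.property.1))
  · exact fun i _ => pow_ne_zero _ (pow_ne_zero _ (h0 i i.property.1))
  · exact fun p _ => div_ne_zero (h0 _ p.property.2.1) (h0 _ p.property.2.2.1)
  · exact Finset.prod_ne_zero_iff.mpr fun i _ => pow_ne_zero _ (pow_ne_zero _ (h0 i i.property.1))
  · exact Finset.prod_ne_zero_iff.mpr fun j _ => pow_ne_zero _ (inv_ne_zero (h0 j j.property.1))
  · exact Finset.prod_ne_zero_iff.mpr fun p _ =>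
      div_ne_zero (h0 _ p.property.2.1) (h0 _ p.property.2.2.1)
  · exact mul_ne_zero
      (Finset.prod_ne_zero_iff.mpr fun i _ => pow_ne_zero _ (pow_ne_zero _ (h0 i i.property.1)))
      (Finset.prod_ne_zero_iff.mpr fun j _ => pow_ne_zero _ (inv_ne_zero (h0 j j.property.1)))

end Orthogonal

/-! ### Norms from the unramified quadratic extension -/

section Norm

variable {k E : Type*} [Field k] [ValuativeRel k] [Field E] [ValuativeRel E] [Algebra k E]
  [ValuativeExtension k E]

theorem valuation_algebraMap_le_iff (a b : k) :
    valuation E (algebraMap k E a) ≤ valuation E (algebraMap k E b) ↔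
      valuation k a ≤ valuation k b := by
  rw [← ValuativeExtension.mapValueGroupWithZero_valuation,
    ← ValuativeExtension.mapValueGroupWithZero_valuation]
  exact ValuativeExtension.mapValueGroupWithZero_strictMono.le_iff_le

theorem valuation_algebraMap_le_one_iff (a : k) :
    valuation E (algebraMap k E a) ≤ 1 ↔ valuation k a ≤ 1 := by
  simpa using valuation_algebraMap_le_iff (E := E) a 1

theorem valuation_algebraMap_lt_one_iff (a : k) :
    valuation E (algebraMap k E a) < 1 ↔ valuation k a < 1 := by
  simpa using (valuation_algebraMap_le_iff (E := E) 1 a).not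

theorem residue_eq_iff {F : Type*} [Field F] [ValuativeRel F] (x y : 𝒪[F]) :
    IsLocalRing.residue 𝒪[F] x = IsLocalRing.residue 𝒪[F] y ↔
      valuation F (x.val - y.val) < 1 := by
  rw [← sub_eq_zero, ← map_sub, IsLocalRing.residue_eq_zero_iff, IsLocalRing.mem_maximalIdeal,
    mem_nonunits_iff]
  exact Valuation.Integer.not_isUnit_iff_valuation_lt_one

/-- If the residue field grows, some integer is not congruent to an element of the base field. -/
theorem exists_integer_not_congruent [Finite 𝓀[k]] (h : Nat.card 𝓀[k] < Nat.card 𝓀[E]) :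
    ∃ ω : E, valuation E ω ≤ 1 ∧
      ∀ a : k, valuation k a ≤ 1 → valuation E (ω - algebraMap k E a) = 1 := by
  have hlift : ∀ x : 𝓀[k], ∃ a : 𝒪[k], IsLocalRing.residue 𝒪[k] a = x :=
    IsLocalRing.residue_surjective
  choose s hs using hlift
  have hint : ∀ a : 𝒪[k], algebraMap k E a.val ∈ 𝒪[E] := fun a =>
    (valuation_algebraMap_le_one_iff a.val).mpr a.property
  -- Only the cardinalities matter, so f may be built from arbitrary lifts. An ω whose class f
  -- misses is congruent to no a in 𝒪[k], because a is congruent to the chosen lift of its class.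
  let f : 𝓀[k] → 𝓀[E] := fun x => IsLocalRing.residue 𝒪[E] ⟨algebraMap k E (s x).val, hint (s x)⟩
  have hf : ¬Function.Surjective f := fun hf => (Nat.card_le_card_of_surjective f hf).not_gt h
  obtain ⟨y, hy⟩ := not_forall.mp hf
  obtain ⟨ω, rfl⟩ := IsLocalRing.residue_surjective y
  refine ⟨ω.val, ω.property, fun a ha => ?_⟩
  have hle : valuation E (ω.val - algebraMap k E a) ≤ 1 :=
    (valuation E).map_sub_le ω.property ((valuation_algebraMap_le_one_iff a).mpr ha)
  refine hle.eq_of_not_lt fun hlt => hy ⟨IsLocalRing.residue 𝒪[k] ⟨a, ha⟩, ?_⟩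
  have h1 := (residue_eq_iff _ _).mp (hs (IsLocalRing.residue 𝒪[k] ⟨a, ha⟩))
  have h2 := (valuation_algebraMap_lt_one_iff (E := E) _).mpr h1
  rw [residue_eq_iff]
  dsimp only at h2 ⊢
  rw [map_sub] at h2
  have h3 := (valuation E).map_sub_lt h2 hlt
  rwa [sub_sub_sub_cancel_right] at h3

/-- The basis 1, ω is orthogonal for the valuation. Unless a strictly dominates, b can be factored
out and the hypothesis on ω applied to -a/b, which is integral. -/
theorem valuation_add_mul {ω : E} (hω : valuation E ω ≤ 1)
    (h : ∀ a : k, valuation k a ≤ 1 → valuation E (ω - algebraMap k E a) = 1) (a b : k) :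
    valuation E (algebraMap k E a + algebraMap k E b * ω) =
      max (valuation E (algebraMap k E a)) (valuation E (algebraMap k E b)) := by
  rcases le_or_gt (valuation E (algebraMap k E b)) (valuation E (algebraMap k E a)) with hba | hab
  · rw [max_eq_left hba]
    rcases hba.lt_or_eq with hlt | heq
    · refine Valuation.map_add_eq_of_lt_left _ ?_
      rw [map_mul]
      exact (mul_le_of_le_one_right' hω).trans_lt hlt
    · by_cases hb : b = 0
      · simp [hb]
      have hb' : algebraMap k E b ≠ 0 := by simpa using hb
      have hq : valuation k (-(a / b)) ≤ 1 := by
        rw [← valuation_algebraMap_le_one_iff (E := E), map_neg, Valuation.map_neg, map_div₀,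
          map_div₀, heq]
        exact div_self_le_one _
      have e : algebraMap k E a + algebraMap k E b * ω =
          algebraMap k E b * (ω - algebraMap k E (-(a / b))) := by
        rw [map_neg, map_div₀]
        field_simp
        ring
      rw [e, map_mul, h _ hq, mul_one, heq]
  · rw [max_eq_right hab.le]
    have hb' : algebraMap k E b ≠ 0 := by
      intro h0
      rw [h0, map_zero] at hab
      exact not_lt_zero hab
    have hq : valuation k (-(a / b)) ≤ 1 := by
      rw [← valuation_algebraMap_le_one_iff (E := E), map_neg, Valuation.map_neg, map_div₀,
        map_div₀]
      exact div_le_one_of_le₀ hab.le zero_le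
    have e : algebraMap k E a + algebraMap k E b * ω =
        algebraMap k E b * (ω - algebraMap k E (-(a / b))) := by
      rw [map_neg, map_div₀]
      field_simp
      ring
    rw [e, map_mul, h _ hq, mul_one]

variable [TopologicalSpace k] [IsNonarchimedeanLocalField k]

/-- No ramification means x = uz with u a unit and z in k. Then N(x) = N(u)z², and N(u) is a unit
since N maps integers to integers. -/
theorem even_ord_norm (hfin : Module.finrank k E = 2)
    (hcard : Nat.card 𝓀[k] < Nat.card 𝓀[E]) {x : E} (hx : x ≠ 0) :
    Even (ord k (Algebra.norm k x)) := by
  obtain ⟨ω, hω, hω'⟩ := exists_integer_not_congruent hcard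
  have hval := valuation_add_mul hω hω'
  have hli : LinearIndependent k ![1, ω] := by
    rw [LinearIndependent.pair_iff]
    intro a b hab
    rw [Algebra.smul_def, Algebra.smul_def, mul_one] at hab
    have h0 := hval a b
    rw [hab, map_zero] at h0
    have h1 := (le_max_left _ _).trans h0.symm.le
    have h2 := (le_max_right _ _).trans h0.symm.le
    simpa using And.intro h1 h2
  let B := basisOfLinearIndependentOfCardEqFinrank hli (by simp [hfin])
  have hB : ∀ i, B i = ![1, ω] i := fun i => by simp [B]
  have hrepr : ∀ y : E, y = algebraMap k E (B.repr y 0) + algebraMap k E (B.repr y 1) * ω := by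
    intro y
    conv_lhs => rw [← B.sum_repr y, Fin.sum_univ_two, hB, hB]
    simp [Algebra.smul_def]
  have hint : ∀ y : E, valuation E y ≤ 1 → ∀ i, B.repr y i ∈ 𝒪[k] := by
    intro y hy i
    rw [hrepr y, hval] at hy
    have h1 := (valuation_algebraMap_le_one_iff _).mp ((le_max_left _ _).trans hy)
    have h2 := (valuation_algebraMap_le_one_iff _).mp ((le_max_right _ _).trans hy)
    fin_cases i
    · exact h1
    · exact h2
  have hBle : ∀ i, valuation E (B i) ≤ 1 := by
    intro i
    rw [hB]
    fin_cases i
    · simp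
    · simpa using hω
  -- In the basis 1, ω, multiplication by an integer has an integral matrix, because the coordinates
  -- of an integer are integral by orthogonality.
  have hnorm : ∀ y : E, valuation E y ≤ 1 → Algebra.norm k y ∈ 𝒪[k] := by
    intro y hy
    have hent : ∀ i j, Algebra.leftMulMatrix B y i j ∈ 𝒪[k] := by
      intro i j
      rw [Algebra.leftMulMatrix_eq_repr_mul]
      refine hint _ ?_ i
      rw [map_mul]
      exact mul_le_one' hy (hBle j)
    rw [Algebra.norm_eq_matrix_det B, Matrix.det_fin_two]
    exact sub_mem (mul_mem (hent _ _) (hent _ _)) (mul_mem (hent _ _) (hent _ _))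
  -- The valuation of x is the maximum of those of its two terms, so one of the coordinates of x can
  -- serve as z.
  obtain ⟨z, hz⟩ : ∃ z : k, valuation E (algebraMap k E z) = valuation E x := by
    have h1 := hval (B.repr x 0) (B.repr x 1)
    rw [← hrepr x] at h1
    rcases max_choice (valuation E (algebraMap k E (B.repr x 0)))
      (valuation E (algebraMap k E (B.repr x 1))) with h | h
    · exact ⟨_, (h1.trans h).symm⟩
    · exact ⟨_, (h1.trans h).symm⟩
  have hvx : valuation E x ≠ 0 := by simpa using hx
  have hz0 : z ≠ 0 := by
    rintro rfl
    rw [map_zero, map_zero] at hz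
    exact hvx hz.symm
  have hzE : algebraMap k E z ≠ 0 := by simpa using hz0
  have hu : valuation E (x / algebraMap k E z) = 1 := by
    rw [map_div₀, hz, div_self hvx]
  have hu' : valuation E (x / algebraMap k E z)⁻¹ = 1 := by rw [map_inv₀, hu, inv_one]
  have hu0 : x / algebraMap k E z ≠ 0 := div_ne_zero hx hzE
  have hordu : ord k (Algebra.norm k (x / algebraMap k E z)) = 0 := by
    refine ord_eq_zero_of_integral (hnorm _ hu.le) (hnorm _ hu'.le) ?_
    rw [← map_mul, mul_inv_cancel₀ hu0, map_one]
  have : FiniteDimensional k E := FiniteDimensional.of_finrank_eq_succ hfin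
  have hfac : x = x / algebraMap k E z * algebraMap k E z := (div_mul_cancel₀ x hzE).symm
  rw [hfac, map_mul, ord_mul (Algebra.norm_ne_zero_iff.mpr hu0) (Algebra.norm_ne_zero_iff.mpr hzE), hordu, zero_add,
    Algebra.norm_algebraMap, hfin, ord_pow hz0]
  exact even_two_mul _

end Norm

/-! ### Parity for a hermitian form over the unramified quadratic extension -/

section Unitary

variable {k E : Type*} [Field k] [CharZero k] [ValuativeRel k] [TopologicalSpace k]
  [IsNonarchimedeanLocalField k] [Field E] [ValuativeRel E] [Algebra k E] [ValuativeExtension k E]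
  {m r : ℕ}

/-- E/k is Galois of degree 2, so its group consists of the identity and c. -/
theorem norm_eq_mul_conj {k E : Type*} [Field k] [CharZero k] [Field E] [Algebra k E]
    (hfin : Module.finrank k E = 2) {c : E ≃ₐ[k] E} (hc : c ≠ AlgEquiv.refl) (x : E) :
    algebraMap k E (Algebra.norm k x) = x * c x := by
  have : FiniteDimensional k E := FiniteDimensional.of_finrank_eq_succ hfin
  have : Algebra.IsQuadraticExtension k E := ⟨hfin⟩
  have hcard : Fintype.card (E ≃ₐ[k] E) = 2 := by
    rw [← Nat.card_eq_fintype_card, IsGalois.card_aut_eq_finrank, hfin]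
  classical
  have huniv : (Finset.univ : Finset (E ≃ₐ[k] E)) = {AlgEquiv.refl, c} := by
    symm
    rw [← Finset.card_eq_iff_eq_univ, Finset.card_pair hc.symm, hcard]
  rw [Algebra.norm_eq_prod_automorphisms, huniv, Finset.prod_pair hc.symm]
  rfl

theorem conj_conj {k E : Type*} [Field k] [CharZero k] [Field E] [Algebra k E]
    (hfin : Module.finrank k E = 2) {c : E ≃ₐ[k] E} (hc : c ≠ AlgEquiv.refl) (x : E) :
    c (c x) = x := by
  by_cases hx : x = 0
  · simp [hx]
  have h := congrArg c (norm_eq_mul_conj hfin hc x)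
  rw [AlgEquiv.commutes, norm_eq_mul_conj hfin hc, map_mul, mul_comm] at h
  exact (mul_left_cancel₀ (by simpa using hx) h).symm

/-- There is no middle block, and tᵢ c(tᵢ) is the norm of tᵢ; hence every factor of the determinant
is a power of a norm. -/
theorem GroupDatum.IsQuasiSplit.even_ord_det_Ad_unitary {D : GroupDatum k E m r} {c : E ≃ₐ[k] E}
    {J : Matrix (Fin m) (Fin m) E} {d : Fin m → E} {ε : E}
    (h : D.IsQuasiSplit c J (fun _ => True) d ε) (hfin : Module.finrank k E = 2)
    (hcard : Nat.card 𝓀[k] < Nat.card 𝓀[E]) (hc : c ≠ AlgEquiv.refl) (t : D.torus) :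
    Even (ord k (LinearMap.det (D.Ad t))) := by
  have : FiniteDimensional k E := FiniteDimensional.of_finrank_eq_succ hfin
  have h0 : ∀ i, t.val.val.val i i ≠ 0 := fun i => h.diag_ne_zero t trivial
  have hempty : IsEmpty {l : Fin m // ¬True} := ⟨fun l => l.property trivial⟩
  have hdet : (GroupDatum.IsQuasiSplit.middle (fun _ => True) t).det = 1 := Matrix.det_isEmpty
  rw [h.det_Ad t (fun i => Algebra.norm k (t.val.val.val i i))
    fun i _ => norm_eq_mul_conj hfin hc _, hdet, Fintype.card_eq_zero]
  have hn : ∀ x : E, x ≠ 0 → Algebra.norm k x ≠ 0 := fun x hx => by simpa using hx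
  simp only [pow_zero, mul_one, map_one, Finset.prod_const_one]
  have h1 : ∀ i j, Algebra.norm k (t.val.val.val i i / t.val.val.val j j) ≠ 0 := fun i j =>
    hn _ (div_ne_zero (h0 i) (h0 j))
  rw [ord_mul (Finset.prod_ne_zero_iff.mpr fun p _ => h1 _ _)
    (Finset.prod_ne_zero_iff.mpr fun i _ => pow_ne_zero _ (hn _ (h0 _))),
    ord_prod _ _ fun p _ => h1 _ _, ord_prod _ _ fun i _ => pow_ne_zero _ (hn _ (h0 _))]
  refine Even.add (Finset.even_sum _ fun p _ => ?_) (Finset.even_sum _ fun i _ => ?_)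
  · exact even_ord_norm hfin hcard (div_ne_zero (h0 _) (h0 _))
  · rw [ord_pow (hn _ (h0 _))]
    exact (even_ord_norm hfin hcard (h0 _)).mul_left _

end Unitary

/-! ### Comparison of transfers -/

section ConjDatum

variable {k R : Type*} [Field k] [Field R] [Algebra k R] {m r : ℕ}
variable [ValuativeRel R] [TopologicalSpace R] [IsNonarchimedeanLocalField R]

theorem GroupDatum.unramifiedCharacter_const (D : GroupDatum k R m r)
    (hD : D.HasSingletonBlocks) (ε : ℂˣ) (t : D.torus) :
    D.unramifiedCharacter hD (fun _ => ε) t = ε ^ ∑ i : Fin r,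
      ord R (t.val.val.val (Fin.castLE D.rank_le i) (Fin.castLE D.rank_le i)) := by
  show ∏ i : Fin r, ε ^ _ = _
  generalize (Finset.univ : Finset (Fin r)) = s
  induction s using Finset.cons_induction with
  | empty => simp
  | cons a s ha ih => rw [Finset.prod_cons, Finset.sum_cons, zpow_add, ih]

variable [ValuativeRel k] [TopologicalSpace k] [IsNonarchimedeanLocalField k]

/-- On the torus, `σ(δ_B^{1/2}) = η ψ δ_B^{1/2}`, where `η` is an unramified character of the
group and `ψ` the unramified character of the torus whose parameters are all equal to `ε`. -/
structure GroupDatum.IsConjDatum (D : GroupDatum k R m r) (σ : ℂ ≃+* ℂ) (η : D.group →* ℂˣ)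
    (ε : ℂˣ) : Prop where
  singleton : D.HasSingletonBlocks
  isOpen : IsOpen {g | η g = 1}
  integral : ∀ g ∈ D.integral, η g = 1
  unipotent : ∀ u ∈ D.unipotent, η u = 1
  modulus : ∀ t : D.torus, σ (Real.sqrt (D.modulus t) : ℂ) =
    η t.val * (D.unramifiedCharacter singleton (fun _ => ε) t * (Real.sqrt (D.modulus t) : ℂ))

theorem GroupDatum.IsConjDatum.of_modulus {D : GroupDatum k R m r} (hD : D.HasSingletonBlocks)
    {σ : ℂ ≃+* ℂ} {ε : ℂˣ}
    (h : ∀ t : D.torus, σ (Real.sqrt (D.modulus t) : ℂ) =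
      (ε ^ ∑ i : Fin r, ord R (t.val.val.val (Fin.castLE D.rank_le i) (Fin.castLE D.rank_le i)) :
        ℂˣ) * (Real.sqrt (D.modulus t) : ℂ)) : D.IsConjDatum σ 1 ε where
  singleton := hD
  isOpen := by simp
  integral _ _ := rfl
  unipotent _ _ := rfl
  modulus t := by
    rw [h, D.unramifiedCharacter_const]
    simp

variable {V V' W W' : Type*} [AddCommGroup V] [Module ℂ V] [AddCommGroup V'] [Module ℂ V']
  [AddCommGroup W] [Module ℂ W] [AddCommGroup W'] [Module ℂ W']

theorem IsTransfer.of_twistedEquiv {D : GroupDatum k R m r} {N : ℕ}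
    {L : (Fin r → ℂˣ) → Matrix (Fin N) (Fin N) ℂ} {σ : ℂ ≃+* ℂ} {η : (gl R N).group →* ℂˣ}
    {π : Representation ℂ D.group V} {π' : Representation ℂ D.group V'}
    {Pi : Representation ℂ (gl R N).group W} {Pi' : Representation ℂ (gl R N).group W'}
    (e : TwistedEquiv σ 1 π π') (f : TwistedEquiv σ η Pi Pi') {ε ε' : ℂˣ}
    (hD : D.IsConjDatum σ 1 ε) (hgl : (gl R N).IsConjDatum σ η ε')
    (hL : ∀ α : Fin r → ℂˣ, L (fun i => ε * Units.map (σ : ℂ →* ℂ) (α i)) =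
      (ε' : ℂ) • (L α).map σ) (h : IsTransfer D L π Pi) : IsTransfer D L π' Pi' := by
  obtain ⟨α, β, hα, hβ, A, hA⟩ := h
  refine ⟨_, _, hα.of_twistedEquiv hD.singleton e hD.isOpen hD.integral hD.unipotent hD.modulus,
    hβ.of_twistedEquiv hgl.singleton f hgl.isOpen hgl.integral hgl.unipotent hgl.modulus,
    -- Applying σ to the entries of a conjugating matrix gives one for the conjugated parameters;
    -- the scalar ε' passes through conjugation.
    Matrix.GeneralLinearGroup.map (σ : ℂ →+* ℂ) A, ?_⟩
  rw [hL, ← map_inv]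
  show A.val.map σ * ((ε' : ℂ) • (L α).map σ) * (A⁻¹).val.map σ = _
  rw [Matrix.mul_smul, Matrix.smul_mul, ← Matrix.map_mul, ← Matrix.map_mul, hA,
    Matrix.diagonal_map (map_zero σ), ← Matrix.diagonal_smul]
  congr 1

/-- The converse is the direct implication for σ⁻¹ and the inverse equivalences. `hη` says that the
inverse of a twist by η is again a twist by η. -/
theorem isTransfer_iff {D : GroupDatum k R m r} {N : ℕ}
    {L : (Fin r → ℂˣ) → Matrix (Fin N) (Fin N) ℂ} {σ : ℂ ≃+* ℂ} {η : (gl R N).group →* ℂˣ}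
    {π : Representation ℂ D.group V} {π' : Representation ℂ D.group V'}
    {Pi : Representation ℂ (gl R N).group W} {Pi' : Representation ℂ (gl R N).group W'}
    (e : TwistedEquiv σ 1 π π') (f : TwistedEquiv σ η Pi Pi') {ε ε' : ℂˣ}
    (hη : ∀ g, σ (η g) = (η g : ℂ)⁻¹)
    (hD : ∀ τ : ℂ ≃+* ℂ, τ = σ ∨ τ = σ.symm → D.IsConjDatum τ 1 ε)
    (hgl : ∀ τ : ℂ ≃+* ℂ, τ = σ ∨ τ = σ.symm → (gl R N).IsConjDatum τ η ε')
    (hL : ∀ (τ : ℂ ≃+* ℂ) (α : Fin r → ℂˣ), L (fun i => ε * Units.map (τ : ℂ →* ℂ) (α i)) =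
      (ε' : ℂ) • (L α).map τ) : IsTransfer D L π Pi ↔ IsTransfer D L π' Pi' :=
  ⟨IsTransfer.of_twistedEquiv e f (hD σ (Or.inl rfl)) (hgl σ (Or.inl rfl)) (hL σ),
    IsTransfer.of_twistedEquiv (e.symm 1 (by simp)) (f.symm η hη) (hD _ (Or.inr rfl))
      (hgl _ (Or.inr rfl)) (hL _)⟩

end ConjDatum

/-! ### The general linear group -/

section GeneralLinear

variable {F : Type*} [Field F]

theorem gl_hasSingletonBlocks (N : ℕ) : (gl F N).HasSingletonBlocks :=
  fun _ _ h => gl_block F N _ _ h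

variable [ValuativeRel F]

theorem det_mem_integer {N : ℕ} {A : Matrix (Fin N) (Fin N) F} (hA : ∀ i j, A i j ∈ 𝒪[F]) :
    A.det ∈ 𝒪[F] := by
  rw [Matrix.det_apply]
  exact sum_mem fun τ _ => zsmul_mem (prod_mem fun i _ => hA _ _) _

variable [TopologicalSpace F] [IsNonarchimedeanLocalField F]

/-- The unramified character `g ↦ ε ^ ord(det g)` of `GL(N)`. -/
def ordDetCharacter (F : Type*) [Field F] [ValuativeRel F] [TopologicalSpace F]
    [IsNonarchimedeanLocalField F] (N : ℕ) (ε : ℂˣ) : (gl F N).group →* ℂˣ where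
  toFun g := ε ^ ord F g.val.val.det
  map_one' := by simp [ord_one]
  map_mul' g h := by
    have h1 : ∀ g : GL (Fin N) F, g.val.det ≠ 0 := fun g =>
      (Matrix.isUnits_det_units g).ne_zero
    rw [← zpow_add, ← ord_mul (h1 _) (h1 _), ← Matrix.det_mul]
    rfl

theorem ordDetCharacter_eq_one {N : ℕ} (ε : ℂˣ) {g : (gl F N).group}
    (h : g.val.val.det ∈ 𝒪[F]) (h' : (g⁻¹).val.val.det ∈ 𝒪[F]) :
    ordDetCharacter F N ε g = 1 := by
  show ε ^ ord F g.val.val.det = 1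
  have h1 : g.val.val.det * (g⁻¹).val.val.det = 1 := by
    rw [← Matrix.det_mul]
    show (g.val.val * (g.val⁻¹).val).det = 1
    rw [Units.mul_inv, Matrix.det_one]
  rw [ord_eq_zero_of_integral h h' h1, zpow_zero]

theorem isOpen_ordDetCharacter (N : ℕ) (ε : ℂˣ) :
    IsOpen {g | ordDetCharacter F N ε g = 1} := by
  refine (ordDetCharacter F N ε).ker.isOpen_of_mem_nhds (g := 1) ?_
  have hc : Continuous fun g : (gl F N).group => g.val.val.det :=
    (Units.continuous_val.comp continuous_subtype_val).matrix_det
  have hO : IsOpen (𝒪[F] : Set F) := Valuation.isOpen_integer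
  refine Filter.mem_of_superset (((hO.preimage hc).inter
    (hO.preimage (hc.comp continuous_inv))).mem_nhds ⟨?_, ?_⟩) ?_
  · simp
  · simp
  · rintro g ⟨h, h'⟩
    exact ordDetCharacter_eq_one ε h h'

/-- With η trivial, the whole sign ε^{(N-1) ∑ ord tᵢ} goes into the Satake parameter. -/
theorem gl_isConjDatum {N : ℕ} {σ : ℂ ≃+* ℂ} {ε : ℂˣ} (hε : ε ^ 2 = 1)
    (h : σ (Real.sqrt (Nat.card 𝓀[F]) : ℂ) = ε * (Real.sqrt (Nat.card 𝓀[F]) : ℂ)) {ε' : ℂˣ}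
    (hε' : ε' = ε ^ ((N : ℤ) - 1)) : (gl F N).IsConjDatum σ 1 ε' := by
  refine GroupDatum.IsConjDatum.of_modulus (gl_hasSingletonBlocks N) fun t => ?_
  rw [(gl F N).map_sqrt_modulus hε h, hε', ← zpow_mul,
    sign_zpow_congr hε (gl_even_ord_det_Ad t)]
  rfl

/-- For N = 2n the sign is ε^{∑ ord tᵢ} = ε^{ord det t}, the restriction of a character of the
group. Taken as η, it leaves no sign for the Satake parameter. -/
theorem gl_isConjDatum_twist {n : ℕ} {σ : ℂ ≃+* ℂ} {ε : ℂˣ} (hε : ε ^ 2 = 1)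
    (h : σ (Real.sqrt (Nat.card 𝓀[F]) : ℂ) = ε * (Real.sqrt (Nat.card 𝓀[F]) : ℂ)) :
    (gl F (2 * n)).IsConjDatum σ (ordDetCharacter F (2 * n) ε) 1 where
  singleton := gl_hasSingletonBlocks _
  isOpen := isOpen_ordDetCharacter _ _
  integral g hg := ordDetCharacter_eq_one ε (det_mem_integer fun i j => (hg i j).1)
    (det_mem_integer fun i j => (hg i j).2)
  unipotent u hu := by
    show ε ^ ord F u.val.val.det = 1
    rw [Matrix.det_of_isUpperTriangular, Finset.prod_eq_one, ord_one, zpow_zero]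
    · intro i _
      rw [hu i i le_rfl, Matrix.one_apply_eq]
    · intro i j hij
      have hij' : j < i := hij
      rw [hu i j hij'.le, Matrix.one_apply_ne hij'.ne']
  modulus t := by
    have hdet : t.val.val.val.det = ∏ i, t.val.val.val i i := by
      refine Matrix.det_of_isUpperTriangular fun i j hij => ?_
      have hij' : j < i := hij
      exact (t.property i j fun hb => hij'.ne' (gl_block F _ _ _ hb)).1
    rw [(gl F (2 * n)).map_sqrt_modulus hε h, GroupDatum.unramifiedCharacter_const, one_zpow,
      Units.val_one, one_mul]
    congr 2
    show _ = ε ^ ord F t.val.val.val.det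
    rw [hdet, ord_prod _ _ fun i _ => (gl F (2 * n)).torus_diag_ne_zero (gl_block F _ i) t]
    refine sign_zpow_congr hε ?_
    have h1 := gl_even_ord_det_Ad t
    have h2 : Even ((((2 * n : ℕ) : ℤ) - 2) * ∑ i, ord F (t.val.val.val i i)) :=
      Even.mul_right ⟨(n : ℤ) - 1, by push_cast; ring⟩ _
    have h3 : ∀ a M S : ℤ, Even (a - (M - 1) * S) → Even ((M - 2) * S) → Even (a - S) := by
      intro a M S ha hb
      rw [show a - S = a - (M - 1) * S + (M - 2) * S by ring]
      exact ha.add hb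
    exact h3 _ _ _ h1 h2

variable {W : Type*} [AddCommGroup W] [Module ℂ W]

theorem map_absDet_half {N : ℕ} {σ : ℂ ≃+* ℂ} {ε : ℂˣ} (hε : ε ^ 2 = 1)
    (h : σ (Real.sqrt (Nat.card 𝓀[F]) : ℂ) = ε * (Real.sqrt (Nat.card 𝓀[F]) : ℂ))
    (g : (gl F N).group) :
    σ (absDet F N (1 / 2) g) = ordDetCharacter F N ε g * absDet F N (1 / 2) g := by
  have h1 : absDet F N (1 / 2) g = (Real.sqrt (normAbs F g.val.val.det) : ℂ) := by
    rw [Real.sqrt_eq_rpow]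
    rfl
  rw [h1, normAbs_of_ne_zero (Matrix.isUnits_det_units g.val).ne_zero]
  exact map_sqrt_zpow hε h _

theorem absDet_half_mul {N : ℕ} (g : (gl F N).group) :
    absDet F N (1 / 2) g * absDet F N (-(1 / 2)) g = 1 := by
  show ((normAbs F g.val.val.det ^ (1 / 2 : ℝ) : ℝ) : ℂ) *
    ((normAbs F g.val.val.det ^ (-(1 / 2) : ℝ) : ℝ) : ℂ) = 1
  have h0 : 0 < normAbs F g.val.val.det := by
    rw [normAbs_of_ne_zero (Matrix.isUnits_det_units g.val).ne_zero]
    have : 0 < (Nat.card 𝓀[F] : ℝ) := by exact_mod_cast Nat.card_pos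
    positivity
  rw [← Complex.ofReal_mul, ← Real.rpow_add h0]
  simp

/-- The representation `^σ(ρ ⊗ | |^{-1/2}) ⊗ | |^{1/2}` is the conjugate of `ρ`, twisted by an
unramified quadratic character. -/
def TwistedEquiv.absDetTwist {N : ℕ} {σ : ℂ ≃+* ℂ} {ε : ℂˣ} (hε : ε ^ 2 = 1)
    (h : σ (Real.sqrt (Nat.card 𝓀[F]) : ℂ) = ε * (Real.sqrt (Nat.card 𝓀[F]) : ℂ))
    (ρ : Representation ℂ (gl F N).group W) :
    TwistedEquiv σ (ordDetCharacter F N ε) ρ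
      (twist (absDet F N (1 / 2)) (conjRep σ (twist (absDet F N (-(1 / 2))) ρ))) where
  toAddEquiv := AddEquiv.refl W
  map_smul := (TwistedEquiv.conj σ ρ).map_smul
  map_rep g v := by
    -- Scalars act on the conjugate through σ⁻¹, the inner twist still acts through the original
    -- structure. The character η makes the two half-powers of |det| cancel.
    show ρ g v = σ.symm (ordDetCharacter F N ε g) • (σ.symm (absDet F N (1 / 2) g) •
      (absDet F N (-(1 / 2)) g • ρ g v))
    rw [smul_smul, smul_smul, ← map_mul, ← map_absDet_half hε h, RingEquiv.symm_apply_apply,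
      absDet_half_mul, one_smul]

theorem ordDetCharacter_map {N : ℕ} (σ : ℂ ≃+* ℂ) {ε : ℂˣ} (hε : ε ^ 2 = 1)
    (g : (gl F N).group) :
    σ (ordDetCharacter F N ε g) = (ordDetCharacter F N ε g : ℂ)⁻¹ := by
  have h1 : (ordDetCharacter F N ε g : ℂ) * ordDetCharacter F N ε g = 1 := by
    rw [← Units.val_mul, Units.val_eq_one, ← sq]
    show (ε ^ ord F g.val.val.det) ^ 2 = 1
    rw [← zpow_natCast, ← zpow_mul, mul_comm, zpow_mul, zpow_natCast, hε, one_zpow]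
  rcases mul_self_eq_one_iff.mp h1 with h | h <;> simp [h]

end GeneralLinear

/-! ### The modulus characters of the classical groups -/

section Antidiagonal

variable {k R : Type*} [Field k] [Field R] [Algebra k R] {m r : ℕ}

theorem GroupDatum.isQuasiSplit_of_antidiagonal {D : GroupDatum k R m r} {c : R ≃ₐ[k] R}
    {J : Matrix (Fin m) (Fin m) R} (d : Fin m → R) (ε : R) (hgroup : D.group ≤ isometryGroup c J)
    (hlie : D.lie = isometryLie c J) (hblock : ∀ i, D.block i = i)
    (hJ : ∀ i j, J i j = if j = i.rev then d i else 0) (hc : ∀ x, c (c x) = x)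
    (hε : ε * ε = 1) (hd : ∀ i, d i ≠ 0) (hcd : ∀ i, c (d i) = d i)
    (hrev : ∀ i, d i.rev = ε * d i) : D.IsQuasiSplit c J (fun _ => True) d ε where
  group_le := hgroup
  lie_eq := hlie
  rev_mem _ _ := trivial
  gram_row i j _ := hJ i j
  gram_mixed i _ h := absurd trivial h
  conj_conj := hc
  gram_conj i j := by
    rw [hJ, hJ]
    by_cases h : j = i.rev
    · subst h
      rw [if_pos (Fin.rev_rev i).symm, if_pos rfl, hcd, hrev]
    · have h' : i ≠ j.rev := fun e => h (by simp [e])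
      simp [h, h']
  sq_eq_one := hε
  entry_ne_zero i _ := hd i
  entry_conj i _ := hcd i
  block_lt i j _ := by
    rw [hblock, hblock]
    exact Fin.lt_def.symm
  block_eq i _ h := absurd trivial h
  lt_middle _ l _ h := absurd trivial h
  middle_lt _ l _ h := absurd trivial h

theorem GroupDatum.hasSingletonBlocks_of_block {D : GroupDatum k R m r}
    (hblock : ∀ i, D.block i = i) : D.HasSingletonBlocks := by
  intro i j h
  rw [hblock, hblock] at h
  exact Fin.ext h

/-- The middle basis vector is its own opposite with Gram entry 2, invertible in characteristic
zero, so it is counted in P. -/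
theorem soOdd_isQuasiSplit [CharZero k] (n : ℕ) :
    (soOdd k n).IsQuasiSplit AlgEquiv.refl (gramOdd k n) (fun _ => True)
      (fun i => if (i : ℕ) = n then 2 else 1) 1 := by
  refine GroupDatum.isQuasiSplit_of_antidiagonal _ _ inf_le_left rfl (fun _ => rfl)
    (fun _ _ => rfl) (fun _ => rfl) (one_mul 1) (fun i => ?_) (fun _ => rfl) (fun i => ?_)
  · split_ifs
    · exact two_ne_zero
    · exact one_ne_zero
  · have : ((i.rev : Fin (2 * n + 1)) : ℕ) = n ↔ (i : ℕ) = n := by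
      rw [Fin.val_rev]
      omega
    simp only [this, one_mul]

theorem soEvenNonsplit_isQuasiSplit (n : ℕ) (a b : k) :
    (soEvenNonsplit k n a b).IsQuasiSplit AlgEquiv.refl (gramNonsplit k n a b)
      (fun i => (i : ℕ) + 1 ≠ n ∧ (i : ℕ) ≠ n) (fun _ => 1) 1 where
  group_le := inf_le_left
  lie_eq := rfl
  rev_mem i hi := by
    rw [Fin.val_rev]
    omega
  gram_row i j hi := by
    simp [gramNonsplit, hi.1, hi.2]
  gram_mixed i j hi hj := by
    have h1 : j ≠ i := by
      rintro rfl
      exact hi hj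
    have h2 : j ≠ i.rev := by
      rintro rfl
      rw [Fin.val_rev] at hj
      omega
    simp [gramNonsplit, h1, h2]
  conj_conj _ := rfl
  gram_conj i j := by
    show gramNonsplit k n a b j i = 1 * gramNonsplit k n a b i j
    rw [one_mul]
    by_cases h : j = i
    · rw [h]
    · have h' : i ≠ j := fun e => h e.symm
      by_cases h2 : j = i.rev
      · subst h2
        have h3 : ((i.rev : Fin (2 * n)) : ℕ) + 1 = n ∨ ((i.rev : Fin (2 * n)) : ℕ) = n ↔
            (i : ℕ) + 1 = n ∨ (i : ℕ) = n := by
          rw [Fin.val_rev]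
          omega
        simp [gramNonsplit, h, h', h3, -Fin.val_rev]
      · have h3 : i ≠ j.rev := fun e => h2 (by simp [e])
        simp [gramNonsplit, h, h', h2, h3]
  sq_eq_one := one_mul 1
  entry_ne_zero _ _ := one_ne_zero
  entry_conj _ _ := rfl
  block_lt i j h := by
    show (if (i : ℕ) = n then n - 1 else (i : ℕ)) < (if (j : ℕ) = n then n - 1 else (j : ℕ)) ↔ _
    rw [Fin.lt_def]
    split_ifs <;> omega
  block_eq i j hi hj := by
    show (if (i : ℕ) = n then n - 1 else (i : ℕ)) = (if (j : ℕ) = n then n - 1 else (j : ℕ))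
    split_ifs <;> omega
  lt_middle i l hi hl := by
    rw [Fin.lt_def, Fin.lt_def, Fin.val_rev]
    omega
  middle_lt i l hi hl := by
    rw [Fin.lt_def, Fin.lt_def, Fin.val_rev]
    omega

theorem card_middle (n : ℕ) :
    Even (Fintype.card {l : Fin (2 * n) // ¬((l : ℕ) + 1 ≠ n ∧ (l : ℕ) ≠ n)}) := by
  rcases n with _ | n
  · have : IsEmpty {l : Fin (2 * 0) // ¬((l : ℕ) + 1 ≠ 0 ∧ (l : ℕ) ≠ 0)} := ⟨fun l => l.val.elim0⟩
    rw [Fintype.card_eq_zero]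
    exact Even.zero
  · rw [Fintype.card_subtype]
    have h : (Finset.univ.filter fun l : Fin (2 * (n + 1)) =>
        ¬((l : ℕ) + 1 ≠ n + 1 ∧ (l : ℕ) ≠ n + 1)) = {⟨n, by omega⟩, ⟨n + 1, by omega⟩} := by
      ext l
      simp only [Finset.mem_filter, Finset.mem_univ, true_and, Finset.mem_insert,
        Finset.mem_singleton, Fin.ext_iff]
      omega
    rw [h, Finset.card_pair (by simp)]
    exact even_two

/-- t has determinant 1, and outside the middle its diagonal entries cancel in pairs i, i.rev; no
index is its own opposite because 2n is even. -/
theorem soEvenNonsplit_middle_det (n : ℕ) (a b : k) (t : (soEvenNonsplit k n a b).torus) :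
    (GroupDatum.IsQuasiSplit.middle (fun i : Fin (2 * n) => (i : ℕ) + 1 ≠ n ∧ (i : ℕ) ≠ n) t).det =
      1 := by
  have hq := soEvenNonsplit_isQuasiSplit n a b
  have hdet : t.val.val.val.det = 1 := by
    have h1 : Matrix.GeneralLinearGroup.det t.val.val = 1 := t.val.property.2
    exact congrArg Units.val h1
  rw [Matrix.twoBlockTriangular_det _ (fun i : Fin (2 * n) => (i : ℕ) + 1 ≠ n ∧ (i : ℕ) ≠ n)
    fun i hi j hj => (t.property i j fun hh => hi (hq.singleton hj i hh ▸ hj)).1] at hdet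
  have hdiag : (Matrix.toSquareBlockProp t.val.val.val
      fun i : Fin (2 * n) => (i : ℕ) + 1 ≠ n ∧ (i : ℕ) ≠ n) =
      Matrix.diagonal fun i => t.val.val.val i.val i.val := by
    ext i j
    by_cases hij : i = j
    · subst hij
      simp [Matrix.toSquareBlockProp]
    · rw [Matrix.diagonal_apply_ne _ hij]
      exact (t.property i.val j.val
        fun hh => hij (Subtype.ext (hq.singleton j.property i.val hh))).1
  rw [hdiag, Matrix.det_diagonal, Finset.prod_ninvolution
    (fun i => ⟨i.val.rev, hq.rev_mem i.val i.property⟩)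
    (fun i => hq.conj_diag_mul t i.property) (fun i _ hi => ?_) (fun i => Finset.mem_univ _)
    (fun i => by simp), one_mul] at hdet
  · exact hdet
  · have h1 := congrArg (fun j => (j.val : ℕ)) hi
    simp only [Fin.val_rev] at h1
    have := i.val.isLt
    omega

end Antidiagonal

/-! ### The sign attached to each classical group -/

section Classical

variable {k : Type*} [Field k] [ValuativeRel k] [TopologicalSpace k] [IsNonarchimedeanLocalField k]
  {m r : ℕ}

theorem GroupDatum.isConjDatum_one {R : Type*} [Field R] [Algebra k R] [ValuativeRel R]
    [TopologicalSpace R] [IsNonarchimedeanLocalField R] {D : GroupDatum k R m r}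
    (hD : D.HasSingletonBlocks) (h : ∀ t : D.torus, Even (ord k (LinearMap.det (D.Ad t))))
    (σ : ℂ ≃+* ℂ) : D.IsConjDatum σ 1 1 := by
  obtain ⟨ε, hε, hσ⟩ := exists_sign σ (q := Nat.card 𝓀[k]) Nat.card_pos.ne'
  refine GroupDatum.IsConjDatum.of_modulus hD fun t => ?_
  rw [D.map_sqrt_modulus hε hσ, sign_zpow_eq_one hε (h t), one_zpow]

theorem GroupDatum.IsQuasiSplit.even_ord_det_Ad_antidiagonal {D : GroupDatum k k m r}
    {J : Matrix (Fin m) (Fin m) k} {d : Fin m → k} {ε : k}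
    (h : D.IsQuasiSplit AlgEquiv.refl J (fun _ => True) d ε) (t : D.torus) :
    Even (ord k (LinearMap.det (D.Ad t)) -
      m * ∑ i ∈ Finset.univ.filter (fun i : Fin m => i < i.rev), ord k (t.val.val.val i i)) := by
  have hempty : IsEmpty {l : Fin m // ¬True} := ⟨fun l => l.property trivial⟩
  have h1 := h.even_ord_det_Ad (by rw [Fintype.card_eq_zero]; exact Even.zero) t
    Matrix.det_isEmpty
  simpa using h1

theorem sum_filter_lt_rev {n : ℕ} (a : Fin (2 * n + 1) → ℤ) (hn : n ≤ 2 * n + 1) :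
    ∑ i ∈ Finset.univ.filter (fun i : Fin (2 * n + 1) => i < i.rev), a i =
      ∑ i : Fin n, a (Fin.castLE hn i) := by
  symm
  refine Finset.sum_bij (fun i _ => Fin.castLE hn i) ?_ ?_ ?_ ?_
  · intro i _
    simp only [Finset.mem_filter, Finset.mem_univ, true_and, Fin.lt_def, Fin.val_rev,
      Fin.val_castLE]
    omega
  · intro i _ j _ h
    simpa using h
  · intro i hi
    simp only [Finset.mem_filter, Finset.mem_univ, true_and, Fin.lt_def, Fin.val_rev] at hi
    exact ⟨⟨i, by omega⟩, Finset.mem_univ _, Fin.ext rfl⟩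
  · intro i _
    rfl

/-- All 2n+1 indices are in P. This odd number is the coefficient of ∑ ord tᵢ, so the sign survives.
-/
theorem soOdd_isConjDatum [CharZero k] (n : ℕ) {σ : ℂ ≃+* ℂ} {ε : ℂˣ} (hε : ε ^ 2 = 1)
    (h : σ (Real.sqrt (Nat.card 𝓀[k]) : ℂ) = ε * (Real.sqrt (Nat.card 𝓀[k]) : ℂ)) :
    (soOdd k n).IsConjDatum σ 1 ε := by
  refine GroupDatum.IsConjDatum.of_modulus
    (GroupDatum.hasSingletonBlocks_of_block fun _ => rfl) fun t => ?_
  rw [(soOdd k n).map_sqrt_modulus hε h]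
  congr 2
  refine sign_zpow_congr hε ?_
  have h1 := (soOdd_isQuasiSplit n).even_ord_det_Ad_antidiagonal t
  rw [sum_filter_lt_rev _ (soOdd k n).rank_le] at h1
  have h2 : ∀ a S : ℤ, Even (a - ((2 * n + 1 : ℕ) : ℤ) * S) → Even (a - S) := by
    intro a S ha
    rw [show a - S = a - ((2 * n + 1 : ℕ) : ℤ) * S + 2 * (n * S) by push_cast; ring]
    exact ha.add (even_two_mul _)
  exact h2 _ _ h1

theorem even_of_even_sub_mul {a b : ℤ} {n : ℕ} (h : Even (a - ((2 * n : ℕ) : ℤ) * b)) :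
    Even a := by
  rw [show a = a - ((2 * n : ℕ) : ℤ) * b + 2 * (n * b) by push_cast; ring]
  exact h.add (even_two_mul _)

theorem sp_isConjDatum (n : ℕ) (σ : ℂ ≃+* ℂ) : (sp k n).IsConjDatum σ 1 1 := by
  have hq : (sp k n).IsQuasiSplit AlgEquiv.refl (gramSymplectic k n) (fun _ => True)
      (fun i => if (i : ℕ) < n then 1 else -1) (-1) := by
    refine GroupDatum.isQuasiSplit_of_antidiagonal _ _ le_rfl rfl (fun _ => rfl)
      (fun _ _ => rfl) (fun _ => rfl) (by ring) (fun i => ?_) (fun _ => rfl) (fun i => ?_)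
    · split_ifs
      · exact one_ne_zero
      · exact neg_ne_zero.mpr one_ne_zero
    · have : ((i.rev : Fin (2 * n)) : ℕ) < n ↔ ¬(i : ℕ) < n := by
        rw [Fin.val_rev]
        omega
      by_cases hi : (i : ℕ) < n <;> simp [this, hi, -Fin.val_rev]
  exact GroupDatum.isConjDatum_one (GroupDatum.hasSingletonBlocks_of_block fun _ => rfl)
    (fun t => even_of_even_sub_mul (hq.even_ord_det_Ad_antidiagonal t)) σ

theorem soEvenSplit_isConjDatum (n : ℕ) (σ : ℂ ≃+* ℂ) :
    (soEvenSplit k n).IsConjDatum σ 1 1 := by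
  have hq : (soEvenSplit k n).IsQuasiSplit AlgEquiv.refl (gramSplit k (2 * n)) (fun _ => True)
      (fun _ => 1) 1 :=
    GroupDatum.isQuasiSplit_of_antidiagonal _ _ inf_le_left rfl (fun _ => rfl)
      (fun _ _ => rfl) (fun _ => rfl) (by ring) (fun _ => one_ne_zero) (fun _ => rfl)
      (fun _ => by ring)
  exact GroupDatum.isConjDatum_one (GroupDatum.hasSingletonBlocks_of_block fun _ => rfl)
    (fun t => even_of_even_sub_mul (hq.even_ord_det_Ad_antidiagonal t)) σ

theorem unitaryU_isConjDatum [CharZero k] {E : Type*} [Field E] [ValuativeRel E]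
    [TopologicalSpace E] [IsNonarchimedeanLocalField E] [Algebra k E] [ValuativeExtension k E]
    {c : E ≃ₐ[k] E} (hfin : Module.finrank k E = 2) (hcard : Nat.card 𝓀[k] < Nat.card 𝓀[E])
    (hc : c ≠ AlgEquiv.refl) (n : ℕ) (σ : ℂ ≃+* ℂ) : (unitaryU c n).IsConjDatum σ 1 1 := by
  have hq : (unitaryU c n).IsQuasiSplit c (gramSplit E n) (fun _ => True) (fun _ => 1) 1 :=
    GroupDatum.isQuasiSplit_of_antidiagonal _ _ le_rfl rfl (fun _ => rfl)
      (fun _ _ => rfl) (conj_conj hfin hc) (by ring) (fun _ => one_ne_zero) (fun _ => map_one c)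
      (fun _ => by ring)
  exact GroupDatum.isConjDatum_one (GroupDatum.hasSingletonBlocks_of_block fun _ => rfl)
    (fun t => hq.even_ord_det_Ad_unitary hfin hcard hc t) σ

theorem soEvenNonsplit_isConjDatum (n : ℕ) (a b : k) (σ : ℂ ≃+* ℂ) :
    (soEvenNonsplit k n a b).IsConjDatum σ 1 1 := by
  have hq := soEvenNonsplit_isQuasiSplit n a b
  refine GroupDatum.isConjDatum_one (fun i j h => ?_) (fun t => ?_) σ
  · refine hq.singleton ⟨?_, ?_⟩ j h <;> rw [Fin.val_castLE] <;> omega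
  · have h1 := hq.even_ord_det_Ad (card_middle n) t (soEvenNonsplit_middle_det n a b t)
    have h2 := card_middle n
    have h3 := Finset.card_filter_add_card_filter_not (s := Finset.univ)
      (fun i : Fin (2 * n) => (i : ℕ) + 1 ≠ n ∧ (i : ℕ) ≠ n)
    rw [Fintype.card_subtype] at h2
    rw [Finset.card_univ, Fintype.card_fin] at h3
    have h4 : Even (Finset.univ.filter
        fun i : Fin (2 * n) => (i : ℕ) + 1 ≠ n ∧ (i : ℕ) ≠ n).card := by
      refine (Nat.even_add.mp ?_).mpr h2
      rw [h3]
      exact even_two_mul n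
    exact (Int.even_sub.mp h1).mpr (Even.mul_right ((Int.even_coe_nat _).mpr h4) _)

end Classical

/-! ### Conjugation of the images of the Satake parameters -/

section DualGroup

theorem dualTorus_conj {r : ℕ} (N : ℕ) (σ : ℂ ≃+* ℂ) (α : Fin r → ℂˣ) :
    dualTorus N (fun i => 1 * Units.map (σ : ℂ →* ℂ) (α i)) = (dualTorus N α).map σ := by
  rw [dualTorus, dualTorus, Matrix.diagonal_map (map_zero σ)]
  congr 1
  ext i
  split_ifs <;> simp

/-- ε⁻¹ = ε, and in size 2n with n parameters no diagonal entry is the default 1, so ε multiplies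
every entry. -/
theorem dualTorus_conj_sign (n : ℕ) (σ : ℂ ≃+* ℂ) {ε : ℂˣ} (hε : ε ^ 2 = 1) (α : Fin n → ℂˣ) :
    dualTorus (2 * n) (fun i => ε * Units.map (σ : ℂ →* ℂ) (α i)) =
      (ε : ℂ) • (dualTorus (2 * n) α).map σ := by
  have hinv : ε⁻¹ = ε := inv_eq_of_mul_eq_one_left (by rw [← sq, hε])
  rw [dualTorus, dualTorus, Matrix.diagonal_map (map_zero σ), ← Matrix.diagonal_smul]
  congr 1
  ext i
  rw [Pi.smul_apply, smul_eq_mul]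
  split_ifs with h h'
  · simp
  · rw [mul_inv, hinv]
    simp
  · rw [Fin.val_rev] at h'
    omega

theorem frobeniusSwap_map (n : ℕ) (σ : ℂ ≃+* ℂ) : (frobeniusSwap n).map σ = frobeniusSwap n := by
  ext i j
  simp only [Matrix.map_apply, frobeniusSwap]
  split_ifs <;> simp

theorem matrix_inv_map {N : ℕ} (σ : ℂ ≃+* ℂ) (A : Matrix (Fin N) (Fin N) ℂ) :
    A⁻¹.map σ = (A.map σ)⁻¹ := by
  have h1 : (A.map σ).det = σ A.det := (RingHom.map_det (σ : ℂ →+* ℂ) A).symm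
  have h2 : (A.map σ).adjugate = A.adjugate.map σ :=
    (RingHom.map_adjugate (σ : ℂ →+* ℂ) A).symm
  rw [Matrix.inv_def, Matrix.inv_def, h1, h2, Ring.inverse_eq_inv', ← map_inv₀]
  ext i j
  simp

theorem unitary_conj {r : ℕ} (n : ℕ) (σ : ℂ ≃+* ℂ) (α : Fin r → ℂˣ) :
    halfTorus n (fun i => 1 * Units.map (σ : ℂ →* ℂ) (α i)) *
        unitaryFrobenius n (halfTorus n (fun i => 1 * Units.map (σ : ℂ →* ℂ) (α i))) =
      (halfTorus n α * unitaryFrobenius n (halfTorus n α)).map σ := by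
  have h1 : halfTorus n (fun i => 1 * Units.map (σ : ℂ →* ℂ) (α i)) = (halfTorus n α).map σ := by
    rw [halfTorus, halfTorus, Matrix.diagonal_map (map_zero σ)]
    congr 1
    ext i
    split_ifs <;> simp
  have h2 : (gramSplit ℂ n).map σ = gramSplit ℂ n := by
    ext i j
    simp only [Matrix.map_apply, gramSplit]
    split_ifs <;> simp
  rw [h1, Matrix.map_mul, unitaryFrobenius, unitaryFrobenius, Matrix.map_mul, Matrix.map_mul,
    matrix_inv_map, h2, Matrix.transpose_map, matrix_inv_map]

end DualGroup

theorem card_residue_lt {k E : Type*} [Field k] [ValuativeRel k] [TopologicalSpace k]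
    [IsNonarchimedeanLocalField k] [Field E] [ValuativeRel E]
    (h : Nat.card 𝓀[E] = Nat.card 𝓀[k] ^ 2) : Nat.card 𝓀[k] < Nat.card 𝓀[E] := by
  have h1 : 1 < Nat.card 𝓀[k] := Finite.one_lt_card
  rw [h]
  nlinarith

end UnramTransfer

end

/-! ### The theorem: matching the signs of the group and of GL(N) -/

theorem lemma9p2 {k : Type*} [Field k] [CharZero k] [ValuativeRel k] [TopologicalSpace k]
    [IsNonarchimedeanLocalField k] (σ : ℂ ≃+* ℂ)
    {V : Type*} [AddCommGroup V] [Module ℂ V] {W : Type*} [AddCommGroup W] [Module ℂ W] :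
    -- (i) `SO(2n+1)`
    (∀ (n : ℕ) (π : Representation ℂ (soOdd k n).group V), (soOdd k n).IsUnramified π →
      (soOdd k n).IsUnramified (conjRep σ π) ∧
      ∀ Pi : Representation ℂ (gl k (2 * n)).group W,
        transferSOOdd k n π Pi ↔ transferSOOdd k n (conjRep σ π) (conjRep σ Pi)) ∧
    -- (i) `Sp(2n)`
    (∀ (n : ℕ) (π : Representation ℂ (sp k n).group V), (sp k n).IsUnramified π →
      (sp k n).IsUnramified (conjRep σ π) ∧
      ∀ Pi : Representation ℂ (gl k (2 * n + 1)).group W,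
        transferSp k n π Pi ↔ transferSp k n (conjRep σ π) (conjRep σ Pi)) ∧
    -- (i) `U(n)`, for the unramified quadratic extension `E` of `k`
    (∀ (E : Type*) [Field E] [ValuativeRel E] [TopologicalSpace E] [IsNonarchimedeanLocalField E]
      [Algebra k E] [ValuativeExtension k E] (c : E ≃ₐ[k] E),
      Module.finrank k E = 2 → Nat.card 𝓀[E] = Nat.card 𝓀[k] ^ 2 → c ≠ AlgEquiv.refl →
      ∀ (n : ℕ) (π : Representation ℂ (unitaryU c n).group V), (unitaryU c n).IsUnramified π →
      (unitaryU c n).IsUnramified (conjRep σ π) ∧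
      ∀ Pi : Representation ℂ (gl E n).group W,
        transferUnitary c n π Pi ↔ transferUnitary c n (conjRep σ π) (conjRep σ Pi)) ∧
    -- (ii) split `SO(2n)`
    (∀ (n : ℕ) (π : Representation ℂ (soEvenSplit k n).group V), (soEvenSplit k n).IsUnramified π →
      (soEvenSplit k n).IsUnramified (conjRep σ π) ∧
      ∀ Pi : Representation ℂ (gl k (2 * n)).group W,
        transferSOEvenSplit k n π Pi ↔
          transferSOEvenSplit k n (conjRep σ π)
            (twist (absDet k (2 * n) (1 / 2))
              (conjRep σ (twist (absDet k (2 * n) (-(1 / 2))) Pi)))) ∧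
    -- (ii) nonsplit `SO(2n)`, split by the unramified quadratic extension of `k`
    (∀ (n : ℕ) (a b : 𝒪[k]),
      Irreducible (Polynomial.X ^ 2 + Polynomial.C (IsLocalRing.residue 𝒪[k] a) * Polynomial.X +
        Polynomial.C (IsLocalRing.residue 𝒪[k] b)) →
      ∀ π : Representation ℂ (soEvenNonsplit k n a.val b.val).group V,
      (soEvenNonsplit k n a.val b.val).IsUnramified π →
      (soEvenNonsplit k n a.val b.val).IsUnramified (conjRep σ π) ∧
      ∀ Pi : Representation ℂ (gl k (2 * n)).group W,
        transferSOEvenNonsplit k n a.val b.val π Pi ↔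
          transferSOEvenNonsplit k n a.val b.val (conjRep σ π)
            (twist (absDet k (2 * n) (1 / 2))
              (conjRep σ (twist (absDet k (2 * n) (-(1 / 2))) Pi)))) := by
  obtain ⟨ε, hε, hσ⟩ := exists_sign σ (q := Nat.card 𝓀[k]) Nat.card_pos.ne'
  have hsign : ∀ τ : ℂ ≃+* ℂ, τ = σ ∨ τ = σ.symm →
      τ (Real.sqrt (Nat.card 𝓀[k]) : ℂ) = ε * (Real.sqrt (Nat.card 𝓀[k]) : ℂ) := by
    rintro τ (rfl | rfl)
    · exact hσ
    · exact sign_symm hε hσ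
  refine ⟨fun n π hπ => ⟨hπ.of_twistedEquiv (.conj σ π) (by simp) (fun _ _ => rfl), fun Pi => ?_⟩,
    fun n π hπ => ⟨hπ.of_twistedEquiv (.conj σ π) (by simp) (fun _ _ => rfl), fun Pi => ?_⟩,
    fun E _ _ _ _ _ _ c hfin hcard hc n π hπ =>
      ⟨hπ.of_twistedEquiv (.conj σ π) (by simp) (fun _ _ => rfl), fun Pi => ?_⟩,
    fun n π hπ => ⟨hπ.of_twistedEquiv (.conj σ π) (by simp) (fun _ _ => rfl), fun Pi => ?_⟩,
    fun n a b _ π hπ => ⟨hπ.of_twistedEquiv (.conj σ π) (by simp) (fun _ _ => rfl), fun Pi => ?_⟩⟩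
  · refine isTransfer_iff (.conj σ π) (.conj σ Pi) (by simp)
      (fun τ hτ => soOdd_isConjDatum n hε (hsign τ hτ))
      (fun τ hτ => gl_isConjDatum hε (hsign τ hτ) (ε' := ε) ?_)
      fun τ α => dualTorus_conj_sign n τ hε α
    rw [← zpow_one ε, ← zpow_mul]
    -- ε^{2n-1} = ε: on both sides the sign is ε.
    exact sign_zpow_congr hε ⟨1 - n, by push_cast; ring⟩
  · refine isTransfer_iff (.conj σ π) (.conj σ Pi) (by simp) (fun τ _ => sp_isConjDatum n τ)
      (fun τ hτ => gl_isConjDatum hε (hsign τ hτ) (ε' := 1) ?_)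
      fun τ α => by rw [Units.val_one, one_smul, dualTorus_conj]
    exact (sign_zpow_eq_one hε ⟨n, by push_cast; ring⟩).symm
  · refine isTransfer_iff (.conj σ π) (.conj σ Pi) (by simp)
      (fun τ _ => unitaryU_isConjDatum hfin (card_residue_lt hcard) hc n τ)
      (fun τ _ => gl_isConjDatum (ε := 1) (by simp) ?_ (ε' := 1) (by simp))
      fun τ α => by rw [Units.val_one, one_smul, unitary_conj]
    -- The square root for E is √(q²) = q, which every σ fixes.
    rw [hcard, Nat.cast_pow, Real.sqrt_sq (Nat.cast_nonneg _)]
    simp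
  · exact isTransfer_iff (.conj σ π) (.absDetTwist hε hσ Pi) (ordDetCharacter_map σ hε)
      (fun τ _ => soEvenSplit_isConjDatum n τ)
      (fun τ hτ => gl_isConjDatum_twist hε (hsign τ hτ))
      fun τ α => by rw [Units.val_one, one_smul, dualTorus_conj]
  · exact isTransfer_iff (.conj σ π) (.absDetTwist hε hσ Pi) (ordDetCharacter_map σ hε)
      (fun τ _ => soEvenNonsplit_isConjDatum n a.val b.val τ)
      (fun τ hτ => gl_isConjDatum_twist hε (hsign τ hτ))
      fun τ α => by
        rw [Units.val_one, one_smul, dualTorus_conj, Matrix.map_mul, frobeniusSwap_map]
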